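/- Let $K,P,Q\ge 1$ be integers and consider a base station serving $K$ legitimate users through a reconfigurable intelligent surface with $M=PQ$ elements under on-off control, with power allocation factors $a_1\ge\dots\ge a_K\ge 0$, $\sum_i a_i=1$, $\nu_k=\sum_{i>k}a_i$, transmit SNRs $\rho,\rho_e>0$ of the legitimate and eavesdropping channels, and residual interference level $\varpi\in[0,1]$ of successive interference cancellation (SIC). Fix $1\le k\le K$ and a target secrecy rate $R>0$. Let $\mathbf h_{br},\mathbf h_{rk},\mathbf h_{re}\in\mathbb C^M$ be independent random vectors with i.i.d. entries of law $\mathcal{CN}(0,N_{br})$, $\mathcal{CN}(0,N_{rk})$, $\mathcal{CN}(0,N_{re})$ (all variances in this statement are positive), let $\mathbf v_p$ be a column of $I_P\otimes\mathbf 1_Q$, and put $H_k=\mathbf v_p^H\mathrm{diag}(\mathbf h_{rk}^H)\mathbf h_{br}$, $H_e=\mathbf v_p^H\mathrm{diag}(\mathbf h_{re}^H)\mathbf h_{br}$. Let $X_k$ be the $k$-th smallest of $K$ independent random variables each distributed as $|H_k|^2$ (the gain of the $k$-th ordered user), and let $h_{ipu}\sim\mathcal{CN}(0,N_{ipu})$,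 $h_{ipe}\sim\mathcal{CN}(0,N_{ipe})$ be such that these $K$ variables, $|h_{ipu}|^2$ and $|h_{ipe}|^2$ are mutually independent. For an eavesdropper channel gain $Z\ge 0$ put $$\gamma_k=\frac{\rho X_k a_k}{\rho X_k\nu_k+\varpi\rho|h_{ipu}|^2+1},\qquad \gamma_E(Z)=\frac{Z a_k\rho_e}{\rho_e Z\nu_k+\varpi\rho_e|h_{ipe}|^2+1},$$ $$P_{out}(Z)=\mathbb P\Big(\big[\log_2(1+\gamma_k)-\log_2(1+\gamma_E(Z))\big]^+<R\Big).$$ The exact secrecy outage probability of the $k$-th ordered user is $P_{out}(|H_e|^2)$; its approximation considered here is $P_{out}(\mathbb E|H_e|^2)$, where the eavesdropper's cascaded gain is replaced by its mean. Let $$\eta(t)=2^{R}\Big(1+\frac{QN_{br}N_{re}a_k\rho_e}{\rho_eQN_{br}N_{re}\nu_k+\varpi\rho_eN_{ipe}t+1}\Big)-1,\qquad \zeta_1(t)=\frac{\varpi\rho N_{ipu}t+1}{\rho N_{br}N_{rk}},\qquad \kappa=\frac{K!}{(K-k)!\,(k-1)!},$$ $$B(x)=1-\frac{2}{\Gamma(Q)}x^{Q/2}K_Q(2\sqrt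 x),$$ with $K_Q$ the modified Bessel function of the second kind, and assume $a_k>\eta(t)\nu_k$ for all $t>0$. Let $L_n(x)=e^x\frac{d^n}{dx^n}(x^ne^{-x})$ be the Laguerre polynomial, $\tau^{(n)}_1,\dots,\tau^{(n)}_n$ its zeros, and $G^{(n)}_j=(n!)^2/\big(\tau^{(n)}_j[L_n'(\tau^{(n)}_j)]^2\big)$ the Gauss–Laguerre weights. Then: (i) $|H_e|^2$ is integrable and $\mathbb E|H_e|^2=QN_{br}N_{re}$. (ii) (Imperfect SIC.) As $S,D\to\infty$ jointly, $$\sum_{s=1}^{S}\sum_{l=0}^{K-k}\sum_{d=1}^{D}\frac{\kappa\,G^{(S)}_sG^{(D)}_d(-1)^l}{k+l}\binom{K-k}{l}\,B\Big(\frac{\eta(\tau^{(S)}_s)\,\zeta_1(\tau^{(D)}_d)}{a_k-\eta(\tau^{(S)}_s)\nu_k}\Big)^{k+l}\longrightarrow P_{out}\big(\mathbb E|H_e|^2\big).$$ (iii) (Perfect SIC.) If $\varpi=0$, then, with $\psi=2^R\Big(1+\frac{QN_{br}N_{re}a_k\rho_e}{\rho_eQN_{br}N_{re}\nu_k+1}\Big)-1$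 and $\zeta_2=\rho N_{br}N_{rk}$, $$P_{out}\big(\mathbb E|H_e|^2\big)=\kappa\sum_{l=0}^{K-k}\binom{K-k}{l}\frac{(-1)^l}{k+l}\,B\Big(\frac{\psi\,\zeta_2^{-1}}{a_k-\psi\nu_k}\Big)^{k+l}.$$ -/

import Mathlib

open MeasureTheory ProbabilityTheory Filter
open scoped Kronecker Matrix

noncomputable section

namespace RISNOMA

/-- The circularly symmetric complex Gaussian law `CN(0, N)`: real and imaginary part are
independent centred Gaussians of variance `N / 2`. -/
def complexGaussian (N : ℝ) : Measure ℂ :=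
  ((gaussianReal 0 (N / 2).toNNReal).prod (gaussianReal 0 (N / 2).toNNReal)).map
    Complex.measurableEquivRealProd.symm

/-- Modified Bessel function of the second kind (integral representation, valid for `0 < x`). -/
def besselK (q x : ℝ) : ℝ :=
  ∫ t in Set.Ioi (0 : ℝ), Real.exp (-x * Real.cosh t) * Real.cosh (q * t)

/-- Laguerre polynomial with the normalization `L_n(x) = eˣ (d/dx)ⁿ (xⁿ e⁻ˣ)`, i.e.
`L_n = ∑ᵢ (-1)ⁱ C(n,i) (n!/i!) xⁱ`, for which the Gauss-Laguerre weights carry `(n!)²`. -/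
def laguerre (n : ℕ) : Polynomial ℝ :=
  ∑ i ∈ Finset.range (n + 1),
    Polynomial.C ((-1 : ℝ) ^ i * (n.choose i : ℝ) * ((n.factorial : ℝ) / (i.factorial : ℝ))) *
      Polynomial.X ^ i

/-- The Gauss-Laguerre nodes of order `n`: the zeros of `L_n`. -/
def laguerreNodes (n : ℕ) : Finset ℝ := (laguerre n).roots.toFinset

/-- The Gauss-Laguerre weight at the node `t`: `(n!)² / (t (L_n'(t))²)`. -/
def laguerreWeight (n : ℕ) (t : ℝ) : ℝ :=
  ((n.factorial : ℝ)) ^ 2 / (t * ((laguerre n).derivative.eval t) ^ 2)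

/-- The matrix `V = I_P ⊗ 1_Q` of the on-off control; the `M = PQ` reflecting elements are
indexed by `Fin P × Fin Q`. -/
def onOffMatrix (P Q : ℕ) : Matrix (Fin P × Fin Q) (Fin P × Unit) ℂ :=
  (1 : Matrix (Fin P) (Fin P) ℂ) ⊗ₖ (Matrix.of fun (_ : Fin Q) (_ : Unit) => (1 : ℂ))

/-- The cascaded channel `v_pᴴ D_r h_br`, where `v_p` is the `p`-th column of `V` and `D_r` is the
diagonal matrix with diagonal `h_rᴴ`. -/
def cascade {P Q : ℕ} (p : Fin P) (hbr hr : Fin P × Fin Q → ℂ) : ℂ :=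
  star (fun m => onOffMatrix P Q m (p, ())) ⬝ᵥ (Matrix.diagonal (star hr) *ᵥ hbr)

/-- The channel gain `|v_pᴴ D_r h_br|²` as a random variable. -/
def cascadeGain {Ω : Type*} {P Q : ℕ} (p : Fin P) (hbr hr : Fin P × Fin Q → Ω → ℂ) (ω : Ω) : ℝ :=
  ‖cascade p (fun m => hbr m ω) (fun m => hr m ω)‖ ^ 2

/-- The order statistic: the entry of index `k` when `x` is sorted increasingly
(so `k = 0` gives the minimum). -/
def orderStat {K : ℕ} (x : Fin K → ℝ) (k : Fin K) : ℝ := x (Tuple.sort x k)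

/-- The deterministic parameters of the network with `K` legitimate users. The users are indexed by
`Fin K`; the user with index `k` is the one of rank `k + 1`. -/
structure SystemParams (K : ℕ) where
  /-- power allocation factors -/
  a : Fin K → ℝ
  /-- transmit SNR of the legitimate channels -/
  ρ : ℝ
  /-- transmit SNR of the eavesdropping channel -/
  ρe : ℝ
  /-- residual interference level of SIC -/
  ϖ : ℝ
  /-- variance of the coefficients from the base station to the RIS -/
  Nbr : ℝ
  /-- variances of the coefficients from the RIS to the users -/
  Nr : Fin K → ℝ
  /-- variance of the coefficients from the RIS to the eavesdropper -/
  Nre : ℝ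
  /-- variance of the residual interference coefficient at the user -/
  Nipu : ℝ
  /-- variance of the residual interference coefficient at the eavesdropper -/
  Nipe : ℝ
  a_nonneg : ∀ i, 0 ≤ a i
  a_antitone : Antitone a
  a_sum : ∑ i, a i = 1
  ρ_pos : 0 < ρ
  ρe_pos : 0 < ρe
  ϖ_nonneg : 0 ≤ ϖ
  ϖ_le_one : ϖ ≤ 1
  Nbr_pos : 0 < Nbr
  Nr_pos : ∀ i, 0 < Nr i
  Nre_pos : 0 < Nre
  Nipu_pos : 0 < Nipu
  Nipe_pos : 0 < Nipe

namespace SystemParams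

variable {K : ℕ} (θ : SystemParams K)

/-- `ν_k = ∑_{i > k} a_i` (zero for the last user). -/
def ν (k : Fin K) : ℝ := ∑ i ∈ Finset.Ioi k, θ.a i

/-- SINR of the user `k` decoding its own message, at channel gain `x` and residual interference
gain `y`. -/
def sinrUser (k : Fin K) (x y : ℝ) : ℝ :=
  θ.ρ * x * θ.a k / (θ.ρ * x * θ.ν k + θ.ϖ * θ.ρ * y + 1)

/-- SINR of the external eavesdropper decoding the message of the user `k`, at channel gain `x` and
residual interference gain `y`. -/
def sinrEve (k : Fin K) (x y : ℝ) : ℝ :=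
  x * θ.a k * θ.ρe / (θ.ρe * x * θ.ν k + θ.ϖ * θ.ρe * y + 1)

/-- Secrecy rate `[log₂(1 + γ_k) - log₂(1 + γ_E)]⁺`, at user gain `x`, eavesdropper gain `z`, and
residual interference gains `yu`, `ye`. -/
def secrecyRate (k : Fin K) (x z yu ye : ℝ) : ℝ :=
  max (Real.logb 2 (1 + θ.sinrUser k x yu) - Real.logb 2 (1 + θ.sinrEve k z ye)) 0

/-- Secrecy outage probability `P(C_k < R)` for random gains: user gain `X`, eavesdropper gain `Z`,
residual interference gains `Yu`, `Ye`. -/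
def secrecyOutageProb {Ω : Type*} [MeasurableSpace Ω] (μ : Measure Ω) (k : Fin K) (R : ℝ)
    (X Z Yu Ye : Ω → ℝ) : ℝ :=
  μ.real {ω | θ.secrecyRate k (X ω) (Z ω) (Yu ω) (Ye ω) < R}

/-- `η(t)`, with the eavesdropper's channel gain equal to `Q N_br N_re`. -/
def η (Q : ℕ) (k : Fin K) (R t : ℝ) : ℝ :=
  (2 : ℝ) ^ R * (1 + (Q : ℝ) * θ.Nbr * θ.Nre * θ.a k * θ.ρe /
    (θ.ρe * (Q : ℝ) * θ.Nbr * θ.Nre * θ.ν k + θ.ϖ * θ.ρe * θ.Nipe * t + 1)) - 1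

/-- `ζ₁(t) = (ϖ ρ N_ipu t + 1) / (ρ N_br N_rk)`. -/
def ζ₁ (k : Fin K) (t : ℝ) : ℝ :=
  (θ.ϖ * θ.ρ * θ.Nipu * t + 1) / (θ.ρ * θ.Nbr * θ.Nr k)

/-- `ζ₂ = ρ N_br N_rk`. -/
def ζ₂ (k : Fin K) : ℝ := θ.ρ * θ.Nbr * θ.Nr k

/-- `ψ`, the value of `η` without residual interference. -/
def ψ (Q : ℕ) (k : Fin K) (R : ℝ) : ℝ :=
  (2 : ℝ) ^ R * (1 + (Q : ℝ) * θ.Nbr * θ.Nre * θ.a k * θ.ρe /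
    (θ.ρe * (Q : ℝ) * θ.Nbr * θ.Nre * θ.ν k + 1)) - 1

end SystemParams

/-- `1 - (2/Γ(Q)) x^{Q/2} K_Q(2√x)`. -/
def bracket (Q : ℕ) (x : ℝ) : ℝ :=
  1 - 2 / Real.Gamma (Q : ℝ) * x ^ ((Q : ℝ) / 2) * besselK (Q : ℝ) (2 * √x)

/-- `κ = K! / ((K - r)! (r - 1)!)` for the rank `r`. -/
def kappa (K r : ℕ) : ℝ :=
  (K.factorial : ℝ) / (((K - r).factorial : ℝ) * ((r - 1).factorial : ℝ))

namespace SystemParams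

variable {K : ℕ} (θ : SystemParams K)

/-- The Gauss-Laguerre triple sum with `S` and `D` nodes, for the user `k` of rank `r = k + 1`. -/
def ipsicSum (Q : ℕ) (k : Fin K) (R : ℝ) (S D : ℕ) : ℝ :=
  let r : ℕ := (k : ℕ) + 1
  ∑ s ∈ laguerreNodes S, ∑ l ∈ Finset.range (K - r + 1), ∑ d ∈ laguerreNodes D,
    kappa K r * laguerreWeight S s * laguerreWeight D d * (-1 : ℝ) ^ l / ((r : ℝ) + (l : ℝ)) *
      ((K - r).choose l : ℝ) *
      bracket Q (θ.η Q k R s * θ.ζ₁ k d / (θ.a k - θ.η Q k R s * θ.ν k)) ^ (r + l)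

/-- The closed form for perfect SIC, for the user `k` of rank `r = k + 1`. -/
def psicSum (Q : ℕ) (k : Fin K) (R : ℝ) : ℝ :=
  let r : ℕ := (k : ℕ) + 1
  kappa K r * ∑ l ∈ Finset.range (K - r + 1),
    ((K - r).choose l : ℝ) * (-1 : ℝ) ^ l / ((r : ℝ) + (l : ℝ)) *
      bracket Q (θ.ψ Q k R * (θ.ζ₂ k)⁻¹ / (θ.a k - θ.ψ Q k R * θ.ν k)) ^ (r + l)

end SystemParams

end RISNOMA

end

/-! Given the vector from the RIS to the receiver, the cascaded channel is a linear combination of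
independent Gaussians, hence complex Gaussian with variance N_br times the squared norm of the Q
active entries. So the gain is N_br N_r times a product of independent variables, one Erlang of
shape Q and one exponential (`map_cascadeGain`). This gives the mean in (i). Averaging the
exponential distribution function over the Erlang variable gives B, through an integral formula for
K_Q (`integral_pow_mul_exp_add_inv`, `bracket_inv`).

Since R > 0 and a_k > ην_k, an outage means that X_k lies below a threshold depending only on the
two interference gains (`secrecyRate_lt_iff`). An order statistic of rank k is below a level iff at
least k of the variables are. The resulting binomial tail, expanded in powers of the common
distribution function, is the alternating sum over l (`sum_bernsteinPolynomial_tail`). Hence P_out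
is a double integral of a bounded continuous function against two unit exponential laws
(`SystemParams.secrecyOutageProb_mean_eq_integral`). For ϖ = 0 the integrand is constant, which is
(iii).

For (ii), the Gauss-Laguerre rule with n nodes is a probability measure with the same moments as the
exponential law in degrees below 2n (`sum_laguerreWeight_mul_eval`). The moments j! grow slowly
enough to force convergence of characteristic functions, so Lévy's theorem yields weak convergence
(`tendsto_quadMeasure`). Weak convergence passes to products, which covers S and D tending to
infinity jointly. -/

noncomputable section

namespace RISNOMA

open MeasureTheory ProbabilityTheory Filter Polynomial
open scoped ENNReal Topology Nat

/-! ### Erlang laws and their moments -/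

/-- The Erlang law of shape `n + 1` and rate one, with density `tⁿ e⁻ᵗ / n!` on `(0, ∞)`. -/
def erlang (n : ℕ) : Measure ℝ :=
  (volume.restrict (Set.Ioi 0)).withDensity
    (fun t => ENNReal.ofReal (t ^ n / n.factorial * Real.exp (-t)))

lemma lintegral_erlang (n : ℕ) (f : ℝ → ℝ≥0∞) (hf : Measurable f) :
    ∫⁻ t, f t ∂erlang n =
      ∫⁻ t in Set.Ioi 0, ENNReal.ofReal (t ^ n / n.factorial * Real.exp (-t)) * f t := by
  rw [erlang, lintegral_withDensity_eq_lintegral_mul _ (by fun_prop) hf]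
  rfl

lemma erlang_density_nonneg (n : ℕ) {t : ℝ} (ht : 0 < t) :
    0 ≤ t ^ n / n.factorial * Real.exp (-t) := by positivity

lemma integral_erlang {E : Type*} [NormedAddCommGroup E] [NormedSpace ℝ E] (n : ℕ) (f : ℝ → E) :
    ∫ t, f t ∂erlang n = ∫ t in Set.Ioi 0, (t ^ n / n.factorial * Real.exp (-t)) • f t := by
  rw [erlang, integral_withDensity_eq_integral_toReal_smul (by fun_prop) (by simp)]
  refine setIntegral_congr_fun measurableSet_Ioi (fun t ht => ?_)
  rw [ENNReal.toReal_ofReal (erlang_density_nonneg n ht)]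

lemma integrable_erlang_iff {E : Type*} [NormedAddCommGroup E] [NormedSpace ℝ E] (n : ℕ)
    (f : ℝ → E) :
    Integrable f (erlang n) ↔
      IntegrableOn (fun t => (t ^ n / n.factorial * Real.exp (-t)) • f t) (Set.Ioi 0) := by
  rw [erlang, integrable_withDensity_iff_integrable_smul' (by fun_prop) (by simp), IntegrableOn]
  refine integrable_congr ?_
  filter_upwards [ae_restrict_mem measurableSet_Ioi] with t ht
  rw [ENNReal.toReal_ofReal (erlang_density_nonneg n ht)]

lemma integrableOn_pow_mul_exp_neg (n : ℕ) :
    IntegrableOn (fun t : ℝ => t ^ n * Real.exp (-t)) (Set.Ioi 0) := by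
  have := Real.GammaIntegral_convergent (s := n + 1) (by positivity)
  refine this.congr_fun (fun t ht => ?_) measurableSet_Ioi
  simp [mul_comm]

lemma integral_pow_mul_exp_neg (n : ℕ) :
    ∫ t in Set.Ioi (0 : ℝ), t ^ n * Real.exp (-t) = n.factorial := by
  rw [← Real.Gamma_nat_eq_factorial, Real.Gamma_eq_integral (by positivity)]
  refine setIntegral_congr_fun measurableSet_Ioi (fun t ht => ?_)
  simp [mul_comm]

instance isProbabilityMeasure_erlang (n : ℕ) : IsProbabilityMeasure (erlang n) := by
  constructor
  rw [← lintegral_one, lintegral_erlang n _ (by fun_prop)]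
  simp only [mul_one]
  have hi : IntegrableOn (fun t : ℝ => t ^ n / n.factorial * Real.exp (-t)) (Set.Ioi 0) := by
    refine ((integrableOn_pow_mul_exp_neg n).div_const (n.factorial : ℝ)).congr ?_
    exact ae_of_all _ fun t => by ring
  rw [← ofReal_integral_eq_lintegral_ofReal hi]
  · have : ∫ t in Set.Ioi (0 : ℝ), t ^ n / n.factorial * Real.exp (-t) = 1 := by
      have h := integral_pow_mul_exp_neg n
      have h2 : ∀ t : ℝ, t ^ n / n.factorial * Real.exp (-t)
          = (t ^ n * Real.exp (-t)) / n.factorial := fun t => by ring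
      simp only [h2, integral_div, h]
      exact div_self (by positivity)
    simp [this]
  · filter_upwards [ae_restrict_mem measurableSet_Ioi] with t ht
    exact erlang_density_nonneg n ht

lemma ae_erlang_pos (n : ℕ) : ∀ᵐ t ∂erlang n, 0 < t := by
  have h : ∀ᵐ t ∂(volume.restrict (Set.Ioi (0 : ℝ))), 0 < t := ae_restrict_mem measurableSet_Ioi
  exact (withDensity_absolutelyContinuous _ _).ae_le h

lemma integrable_pow_erlang (m : ℕ) : Integrable (fun t : ℝ => t ^ m) (erlang 0) := by
  rw [integrable_erlang_iff]
  refine (integrableOn_pow_mul_exp_neg m).congr_fun (fun t _ => ?_) measurableSet_Ioi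
  simp [mul_comm]

lemma integral_pow_erlang (m : ℕ) : ∫ t, t ^ m ∂erlang 0 = m.factorial := by
  rw [integral_erlang, ← integral_pow_mul_exp_neg m]
  refine setIntegral_congr_fun measurableSet_Ioi (fun t _ => ?_)
  simp [mul_comm]

lemma integrable_eval_erlang (p : ℝ[X]) : Integrable (fun t => p.eval t) (erlang 0) := by
  simp only [Polynomial.eval_eq_sum, Polynomial.sum]
  exact integrable_finsetSum _ fun i _ => (integrable_pow_erlang i).const_mul _

/-! ### Laguerre polynomials: orthogonality and zeros -/

/-- The functional `p ↦ ∫₀^∞ p(t) e⁻ᵗ dt` on polynomials. -/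
def expFunctional : ℝ[X] →ₗ[ℝ] ℝ where
  toFun p := ∫ t, p.eval t ∂erlang 0
  map_add' p q := by
    simp only [eval_add]
    exact integral_add (integrable_eval_erlang p) (integrable_eval_erlang q)
  map_smul' c p := by simp [integral_const_mul]

lemma expFunctional_apply (p : ℝ[X]) : expFunctional p = ∫ t, p.eval t ∂erlang 0 := rfl

lemma expFunctional_X_pow (m : ℕ) : expFunctional (X ^ m) = m.factorial := by
  simp [expFunctional_apply, integral_pow_erlang]

lemma expFunctional_C_mul (c : ℝ) (p : ℝ[X]) : expFunctional (C c * p) = c * expFunctional p := by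
  rw [← smul_eq_C_mul, map_smul, smul_eq_mul]

/-- Integration by parts against e⁻ᵗ, leaving the boundary term at 0. By linearity it reduces to
monomials, where it is the recursion of the factorial. -/
lemma expFunctional_derivative (p : ℝ[X]) :
    expFunctional (derivative p) = expFunctional p - p.eval 0 := by
  induction p using Polynomial.induction_on' with
  | add p q hp hq => simp only [map_add, hp, hq, eval_add]; ring
  | monomial n a =>
    rw [← C_mul_X_pow_eq_monomial, derivative_C_mul_X_pow, expFunctional_C_mul,
      expFunctional_C_mul, expFunctional_X_pow, expFunctional_X_pow]
    cases n with
    | zero => simp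
    | succ n => simp [Nat.factorial_succ]; ring

/-- A nonzero polynomial vanishes only on a finite set, which is null for the exponential law. -/
lemma expFunctional_pos {p : ℝ[X]} (h : ∀ t, 0 < t → 0 ≤ p.eval t) (hp : p ≠ 0) :
    0 < expFunctional p := by
  rw [expFunctional_apply, integral_pos_iff_support_of_nonneg_ae
    ((ae_erlang_pos 0).mono fun t ht => h t ht) (integrable_eval_erlang p)]
  have h0 : erlang 0 ((p.roots.toFinset : Finset ℝ) : Set ℝ) = 0 := by
    refine (withDensity_absolutelyContinuous _ _) ?_
    exact Set.Finite.measure_zero (Finset.finite_toSet _) _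
  have hs : Function.support (fun t => p.eval t) = ((p.roots.toFinset : Finset ℝ) : Set ℝ)ᶜ := by
    ext t; simp [hp]
  rw [hs, (prob_compl_eq_one_iff (Finset.measurableSet _)).2 h0]
  exact one_pos


lemma laguerre_coeff (n m : ℕ) : (laguerre n).coeff m =
    if m ≤ n then (-1 : ℝ) ^ m * (n.choose m : ℝ) * ((n.factorial : ℝ) / (m.factorial : ℝ))
    else 0 := by
  simp only [laguerre, finsetSum_coeff, coeff_C_mul, coeff_X_pow, mul_ite, mul_one, mul_zero,
    Finset.sum_ite_eq, Finset.mem_range, Nat.lt_succ_iff]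

lemma natDegree_laguerre (n : ℕ) : (laguerre n).natDegree = n := by
  refine natDegree_eq_of_le_of_coeff_ne_zero ?_ ?_
  · rw [natDegree_le_iff_coeff_eq_zero]
    intro N hN
    rw [laguerre_coeff, if_neg (by omega)]
  · rw [laguerre_coeff, if_pos le_rfl]
    have : (n.factorial : ℝ) ≠ 0 := by positivity
    simp [this]

lemma laguerre_ne_zero (n : ℕ) : laguerre n ≠ 0 := by
  intro h
  have := laguerre_coeff n 0
  have h2 : (n.factorial : ℝ) ≠ 0 := by positivity
  simp [h] at this
  exact h2 this.symm

lemma laguerre_eval_zero (n : ℕ) : (laguerre n).eval 0 = n.factorial := by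
  rw [← coeff_zero_eq_eval_zero, laguerre_coeff]
  simp

/-- Since tⁱ⁺ʲ has moment (i+j)! and (i+j)!/i! is a polynomial of degree j in i, the left side is,
up to a constant, an n-th finite difference of a polynomial of degree j < n. -/
lemma expFunctional_laguerre_mul_X_pow {n j : ℕ} (h : j < n) :
    expFunctional (laguerre n * X ^ j) = 0 := by
  have h1 : expFunctional (laguerre n * X ^ j) = ∑ i ∈ Finset.range (n + 1),
      (-1 : ℝ) ^ i * (n.choose i : ℝ) * n.factorial * ((ascPochhammer ℝ j).comp (X + 1)).eval (i : ℝ) := by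
    rw [laguerre, Finset.sum_mul, map_sum]
    refine Finset.sum_congr rfl fun i _ => ?_
    rw [mul_assoc, ← pow_add, expFunctional_C_mul, expFunctional_X_pow]
    have : ((ascPochhammer ℝ j).comp (X + 1)).eval (i : ℝ) = ((i + 1).ascFactorial j : ℕ) := by
      rw [← ascPochhammer_nat_eq_ascFactorial, ascPochhammer_eval_cast]
      simp
    rw [this]
    have h2 := Nat.factorial_mul_ascFactorial i j
    have h3 : (i.factorial : ℝ) ≠ 0 := by positivity
    rw [← h2]; push_cast; field_simp
  have hd : ((ascPochhammer ℝ j).comp (X + 1)).natDegree < n := by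
    rw [natDegree_comp, ascPochhammer_natDegree]
    have : (X + 1 : ℝ[X]).natDegree = 1 := natDegree_X_add_C (1 : ℝ)
    rw [this]; omega
  have h4 := congrFun (Polynomial.fwdDiff_iter_eq_zero_of_degree_lt hd) 0
  rw [fwdDiff_iter_eq_sum_shift] at h4
  rw [h1]
  have h5 : ∀ i ∈ Finset.range (n + 1),
      (-1 : ℝ) ^ i * (n.choose i : ℝ) * n.factorial * ((ascPochhammer ℝ j).comp (X + 1)).eval (i : ℝ)
      = ((-1 : ℝ) ^ n * n.factorial) * (((-1 : ℤ) ^ (n - i) * n.choose i) •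
        ((ascPochhammer ℝ j).comp (X + 1)).eval (0 + i • (1 : ℝ))) := by
    intro i hi
    have hi' : i ≤ n := by simpa [Nat.lt_succ_iff] using hi
    have : (-1 : ℝ) ^ n * (-1) ^ (n - i) = (-1) ^ i := by
      rw [← pow_add, show n + (n - i) = i + 2 * (n - i) by omega, pow_add, pow_mul]; simp
    rw [← this]
    simp only [zsmul_eq_mul, zero_add, nsmul_eq_mul, mul_one]
    push_cast
    ring
  rw [Finset.sum_congr rfl h5, ← Finset.mul_sum, h4]
  simp

lemma expFunctional_laguerre_mul {n : ℕ} {p : ℝ[X]} (h : p.natDegree < n) :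
    expFunctional (laguerre n * p) = 0 := by
  rw [p.as_sum_range_C_mul_X_pow' h, Finset.mul_sum, map_sum]
  refine Finset.sum_eq_zero fun j hj => ?_
  rw [mul_left_comm, expFunctional_C_mul,
    expFunctional_laguerre_mul_X_pow (Finset.mem_range.1 hj), mul_zero]

/-- If L_n = s q with s nonnegative on (0, ∞) and not constant, then L_n q = s q² has positive
integral, against orthogonality to the lower degree q. Taking s = X - t with t ≤ 0, s = (X - t)², or
s a factor without real zeros shows in turn that the zeros are positive, simple and all real. -/
lemma laguerre_not_nonneg_factor {n : ℕ} {s q : ℝ[X]} (h : laguerre n = s * q)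
    (hs : 0 < s.natDegree) (hpos : ∀ t, 0 < t → 0 ≤ s.eval t) : False := by
  have hne := laguerre_ne_zero n
  rw [h] at hne
  have hs0 := left_ne_zero_of_mul hne
  have hq0 := right_ne_zero_of_mul hne
  have hd : q.natDegree < n := by
    have := natDegree_mul hs0 hq0
    rw [← h, natDegree_laguerre] at this
    omega
  have h1 := expFunctional_laguerre_mul hd
  have h2 : 0 < expFunctional (laguerre n * q) := by
    refine expFunctional_pos (fun t ht => ?_) (by rw [h]; exact mul_ne_zero hne hq0)
    rw [h, eval_mul, eval_mul, mul_assoc]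
    exact mul_nonneg (hpos t ht) (mul_self_nonneg _)
  exact h2.ne' h1

lemma pos_of_isRoot_laguerre {n : ℕ} {t : ℝ} (h : (laguerre n).IsRoot t) : 0 < t := by
  by_contra! ht
  obtain ⟨q, hq⟩ := dvd_iff_isRoot.2 h
  exact laguerre_not_nonneg_factor hq (by simp) fun x hx => by simp; linarith

lemma nodup_roots_laguerre (n : ℕ) : (laguerre n).roots.Nodup := by
  rw [Multiset.nodup_iff_count_le_one]
  intro t
  rw [count_roots]
  by_contra! h
  obtain ⟨q, hq⟩ := (le_rootMultiplicity_iff (laguerre_ne_zero n)).1 h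
  exact laguerre_not_nonneg_factor hq (by simp [natDegree_pow]) fun x hx => by
    simp only [eval_pow]; exact sq_nonneg _

lemma eval_pos_or_neg_of_roots_eq_zero {g : ℝ[X]} (hg : g ≠ 0) (h : g.roots = 0) :
    (∀ t, 0 < g.eval t) ∨ (∀ t, g.eval t < 0) := by
  have hne : ∀ t, g.eval t ≠ 0 := by
    intro t ht
    have : t ∈ g.roots := (mem_roots hg).2 ht
    simp [h] at this
  by_contra! hc
  obtain ⟨⟨a, ha⟩, ⟨b, hb⟩⟩ := hc
  obtain ⟨c, hc⟩ := mem_range_of_exists_le_of_exists_ge g.continuous ⟨a, ha⟩ ⟨b, hb⟩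
  exact hne c hc

/-- The cofactor of the linear factors has no real zero, hence constant sign; up to that sign it is
a nonnegative factor, so it must be constant. -/
lemma card_roots_laguerre (n : ℕ) : (laguerre n).roots.card = n := by
  obtain ⟨g, hg, hd, hr⟩ := exists_prod_multiset_X_sub_C_mul (laguerre n)
  rw [natDegree_laguerre] at hd
  have hg0 : g ≠ 0 := by rintro rfl; simp at hg; exact laguerre_ne_zero n hg.symm
  rcases Nat.eq_zero_or_pos g.natDegree with h0 | h0
  · omega
  exfalso
  rcases eval_pos_or_neg_of_roots_eq_zero hg0 hr with h | h
  · exact laguerre_not_nonneg_factor (s := g) (by rw [← hg, mul_comm]) h0 fun t _ => (h t).le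
  · exact laguerre_not_nonneg_factor (s := -g)
      (q := -((laguerre n).roots.map fun a => X - C a).prod) (by rw [neg_mul_neg, mul_comm, hg])
      (by simpa using h0) fun t _ => by simp [(h t).le]

lemma mem_laguerreNodes {n : ℕ} {t : ℝ} : t ∈ laguerreNodes n ↔ (laguerre n).IsRoot t := by
  simp [laguerreNodes, laguerre_ne_zero]

lemma card_laguerreNodes (n : ℕ) : (laguerreNodes n).card = n := by
  rw [laguerreNodes, Multiset.toFinset_card_of_nodup (nodup_roots_laguerre n),
    card_roots_laguerre]

lemma pos_of_mem_laguerreNodes {n : ℕ} {t : ℝ} (h : t ∈ laguerreNodes n) : 0 < t :=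
  pos_of_isRoot_laguerre (mem_laguerreNodes.1 h)

/-! ### Gauss-Laguerre quadrature: exactness and weights -/

lemma expFunctional_eq_sum_lagrange {n : ℕ} {p : ℝ[X]} (hp : p.natDegree < 2 * n) :
    expFunctional p = ∑ t ∈ laguerreNodes n,
      p.eval t * expFunctional (Lagrange.basis (laguerreNodes n) id t) := by
  have hn : 0 < n := by omega
  have hdm := EuclideanDomain.div_add_mod p (laguerre n)
  have hmod : (p % laguerre n).degree < n := by
    have := EuclideanDomain.mod_lt p (laguerre_ne_zero n)
    have h2 := degree_eq_natDegree (laguerre_ne_zero n)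
    rw [natDegree_laguerre] at h2
    rw [← h2]; exact this
  have hdiv : (p / laguerre n).natDegree < n := by
    rw [div_def]
    refine (natDegree_C_mul_le _ _).trans_lt ?_
    rw [natDegree_divByMonic _ (monic_mul_leadingCoeff_inv (laguerre_ne_zero n)),
      natDegree_mul_leadingCoeff_inv _ (laguerre_ne_zero n), natDegree_laguerre]
    omega
  have hr : p % laguerre n = Lagrange.interpolate (laguerreNodes n) id
      (fun t => (p % laguerre n).eval t) := by
    refine Lagrange.eq_interpolate_of_eval_eq _ (Set.injOn_id _) ?_ fun _ _ => rfl
    rwa [card_laguerreNodes]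
  have h1 : expFunctional p = expFunctional (p % laguerre n) := by
    conv_lhs => rw [← hdm, map_add, expFunctional_laguerre_mul hdiv, zero_add]
  rw [h1, hr, Lagrange.interpolate_apply, map_sum]
  refine Finset.sum_congr rfl fun t ht => ?_
  rw [expFunctional_C_mul]
  congr 1
  conv_rhs => rw [← hdm]
  have : (laguerre n).eval t = 0 := mem_laguerreNodes.1 ht
  simp [this]

/-- Write L_n = (X - t) q, so that q(t) = L_n'(t), and compute the integral of q L_n' in two ways.
Quadrature gives q(t)² times the weight, as q kills every other node. Orthogonality replaces L_n' by
q, and integration by parts for (X - t) q² gives t q(0)². Finally -t q(0) = L_n(0) = n!. -/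
lemma expFunctional_lagrange_basis {n : ℕ} {t : ℝ} (ht : t ∈ laguerreNodes n) :
    expFunctional (Lagrange.basis (laguerreNodes n) id t) = laguerreWeight n t := by
  have hroot := mem_laguerreNodes.1 ht
  have htpos := pos_of_mem_laguerreNodes ht
  obtain ⟨q, hq⟩ := dvd_iff_isRoot.2 hroot
  have hq0 : q ≠ 0 := by rintro rfl; simp at hq; exact laguerre_ne_zero n hq
  have hdeg : q.natDegree + 1 = n := by
    have := natDegree_mul (X_sub_C_ne_zero t) hq0
    rw [← hq, natDegree_laguerre, natDegree_X_sub_C] at this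
    omega
  have hder : derivative (laguerre n) = q + (X - C t) * derivative q := by
    rw [hq, derivative_mul]; simp
  have hdt : (derivative (laguerre n)).eval t = q.eval t := by rw [hder]; simp
  have hq'd : (derivative q).natDegree < n :=
    (natDegree_derivative_le q).trans_lt (by omega)
  have hqt : q.eval t ≠ 0 := by
    intro h0
    obtain ⟨r, hr⟩ := dvd_iff_isRoot.2 h0
    have : 1 < (laguerre n).rootMultiplicity t := by
      rw [← Nat.succ_le_iff, le_rootMultiplicity_iff (laguerre_ne_zero n)]
      exact ⟨r, by rw [hq]; nth_rw 1 [hr]; ring⟩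
    have h2 := Multiset.nodup_iff_count_le_one.1 (nodup_roots_laguerre n) t
    rw [count_roots] at h2
    omega
  have h1 : expFunctional (q * derivative (laguerre n)) =
      q.eval t ^ 2 * expFunctional (Lagrange.basis (laguerreNodes n) id t) := by
    rw [expFunctional_eq_sum_lagrange (n := n), Finset.sum_eq_single_of_mem t ht]
    · rw [eval_mul, hdt]; ring
    · intro s hs hst
      have : (laguerre n).eval s = 0 := mem_laguerreNodes.1 hs
      rw [hq, eval_mul] at this
      have h3 : q.eval s = 0 := by
        refine (mul_eq_zero.1 this).resolve_left ?_
        simpa [sub_eq_zero] using hst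
      simp [h3]
    · refine lt_of_le_of_lt natDegree_mul_le ?_
      have := natDegree_derivative_le (laguerre n)
      rw [natDegree_laguerre] at this
      omega
  -- Here q L_n' = q² + L_n q', and L_n is orthogonal to q'.
  have h2 : expFunctional (q * derivative (laguerre n)) = expFunctional (q * q) := by
    have : q * derivative (laguerre n) = q * q + laguerre n * derivative q := by
      rw [hder, hq]; ring
    rw [this, map_add, expFunctional_laguerre_mul hq'd, add_zero]
  have h3 := expFunctional_derivative ((X - C t) * (q * q))
  have h4 : derivative ((X - C t) * (q * q)) = q * q + C 2 * (laguerre n * derivative q) := by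
    rw [hq]; simp only [derivative_mul, derivative_sub, derivative_X, derivative_C]
    rw [show (C 2 : ℝ[X]) = 2 from rfl]
    ring
  have h5 : (X - C t) * (q * q) = laguerre n * q := by rw [hq]; ring
  have h6 := laguerre_eval_zero n
  rw [hq] at h6
  simp only [eval_mul, eval_sub, eval_X, eval_C, zero_sub] at h6
  rw [h4, map_add, expFunctional_C_mul, expFunctional_laguerre_mul hq'd, h5,
    expFunctional_laguerre_mul (by omega), mul_zero, add_zero, zero_sub, hq] at h3
  simp only [eval_mul, eval_sub, eval_X, eval_C, zero_sub] at h3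
  rw [laguerreWeight, hdt, eq_div_iff (by positivity), ← h6]
  have h7 : q.eval t ^ 2 * expFunctional (Lagrange.basis (laguerreNodes n) id t)
      = t * q.eval 0 * q.eval 0 := by
    rw [← h1, h2, h3]; ring
  calc _ = t * (q.eval t ^ 2 * expFunctional (Lagrange.basis (laguerreNodes n) id t)) := by ring
    _ = _ := by rw [h7]; ring

/-- Gauss-Laguerre quadrature with `n` nodes is exact in degree less than `2 n`. -/
theorem sum_laguerreWeight_mul_eval {n : ℕ} {p : ℝ[X]} (hp : p.natDegree < 2 * n) :
    ∑ t ∈ laguerreNodes n, laguerreWeight n t * p.eval t = ∫ t, p.eval t ∂erlang 0 := by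
  rw [← expFunctional_apply, expFunctional_eq_sum_lagrange hp]
  refine Finset.sum_congr rfl fun t ht => ?_
  rw [expFunctional_lagrange_basis ht, mul_comm]

lemma laguerreWeight_nonneg {n : ℕ} {t : ℝ} (ht : t ∈ laguerreNodes n) :
    0 ≤ laguerreWeight n t := by
  have := pos_of_mem_laguerreNodes ht
  unfold laguerreWeight
  positivity


/-! ### From convergence of moments to convergence of characteristic functions -/

/-- The derivative of the Taylor remainder of order M + 1 is c times the remainder of order M, so
the bound integrates up by induction. As c is imaginary, no exponential factor appears. -/
lemma norm_cexp_mul_sub_sum_le {c : ℂ} (hc : c.re = 0) (M : ℕ) {x : ℝ} (hx : 0 ≤ x) :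
    ‖Complex.exp (c * x) - ∑ m ∈ Finset.range M, (c * x) ^ m / m.factorial‖
      ≤ (‖c‖ * x) ^ M / M.factorial := by
  induction M generalizing x with
  | zero => simp [Complex.norm_exp, hc]
  | succ M ih =>
    have hd : ∀ y : ℝ, HasDerivAt
        (fun x : ℝ => Complex.exp (c * x) - ∑ m ∈ Finset.range (M + 1), (c * x) ^ m / m.factorial)
        (c * (Complex.exp (c * y) - ∑ m ∈ Finset.range M, (c * y) ^ m / m.factorial)) y := by
      intro y
      have h0 : HasDerivAt (fun x : ℝ => c * (x : ℂ)) c y := by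
        simpa using (Complex.ofRealCLM.hasDerivAt (x := y)).const_mul c
      have h1 := h0.cexp
      have h2 : HasDerivAt (fun x : ℝ => ∑ m ∈ Finset.range (M + 1), (c * x) ^ m / m.factorial)
          (∑ m ∈ Finset.range (M + 1), (m * (c * y) ^ (m - 1) * c) / m.factorial) y :=
        HasDerivAt.fun_sum fun m _ => (h0.pow m).div_const _
      convert! h1.sub h2 using 1
      rw [Finset.sum_range_succ', mul_sub, Finset.mul_sum]
      simp only [Nat.cast_zero, zero_mul, zero_div, add_zero]
      congr 1
      · ring
      · refine Finset.sum_congr rfl fun m _ => ?_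
        have h3 : (m.factorial : ℂ) ≠ 0 := by exact_mod_cast m.factorial_ne_zero
        have h4 : ((m : ℂ) + 1) ≠ 0 := by exact_mod_cast m.succ_ne_zero
        simp only [Nat.factorial_succ, Nat.add_sub_cancel]
        push_cast
        field_simp
    refine image_norm_le_of_norm_deriv_right_le_deriv_boundary (a := 0) (b := x)
      (B := fun x => (‖c‖ * x) ^ (M + 1) / (M + 1).factorial)
      (B' := fun x => ‖c‖ * ((‖c‖ * x) ^ M / M.factorial))
      (fun y _ => (hd y).continuousAt.continuousWithinAt)
      (fun y _ => (hd y).hasDerivWithinAt) ?_ ?_ ?_ (Set.right_mem_Icc.2 hx)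
    · simp [Finset.sum_range_succ']
    · intro y
      have h0 : HasDerivAt (fun x : ℝ => ‖c‖ * x) ‖c‖ y := by
        simpa using (hasDerivAt_id y).const_mul ‖c‖
      convert! (h0.pow (M + 1)).div_const ((M + 1).factorial : ℝ) using 1
      have h3 : (M.factorial : ℝ) ≠ 0 := by exact_mod_cast M.factorial_ne_zero
      have h4 : ((M : ℝ) + 1) ≠ 0 := by exact_mod_cast M.succ_ne_zero
      simp only [Nat.factorial_succ, Nat.add_sub_cancel]
      push_cast
      field_simp
    · intro y hy
      rw [norm_mul]
      exact mul_le_mul_of_nonneg_left (ih hy.1) (norm_nonneg _)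

/-- The `j`-th derivative (up to a power of `i`) of the characteristic function. -/
def momentChar (ν : Measure ℝ) (j : ℕ) (ξ : ℝ) : ℂ :=
  ∫ t, (t : ℂ) ^ j * Complex.exp (Complex.I * ξ * t) ∂ν

lemma integrable_pow_mul_cexp {ν : Measure ℝ} {j : ℕ} (h : Integrable (fun t : ℝ => t ^ j) ν)
    (ξ : ℝ) : Integrable (fun t : ℝ => (t : ℂ) ^ j * Complex.exp (Complex.I * ξ * t)) ν := by
  refine h.norm.mono' (by fun_prop) (ae_of_all _ fun t => ?_)
  simp [Complex.norm_exp]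

/-- Taylor expansion in the frequency. The error depends on the measure only through one moment and
not at all on ξ, hence is uniform along a sequence with matching moments. -/
lemma norm_momentChar_add_sub_le {ν : Measure ℝ} (hpos : ∀ᵐ t ∂ν, 0 < t)
    (hint : ∀ j : ℕ, Integrable (fun t : ℝ => t ^ j) ν) (j M : ℕ) (ξ h : ℝ) :
    ‖momentChar ν j (ξ + h) - ∑ m ∈ Finset.range M,
      (Complex.I * h) ^ m / m.factorial * momentChar ν (j + m) ξ‖
      ≤ |h| ^ M / M.factorial * ∫ t, t ^ (j + M) ∂ν := by
  have h1 : momentChar ν j (ξ + h) - ∑ m ∈ Finset.range M,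
      (Complex.I * h) ^ m / m.factorial * momentChar ν (j + m) ξ =
      ∫ t, (t : ℂ) ^ j * Complex.exp (Complex.I * ξ * t) * (Complex.exp (Complex.I * h * t) -
        ∑ m ∈ Finset.range M, (Complex.I * h * t) ^ m / m.factorial) ∂ν := by
    simp only [momentChar, ← integral_const_mul]
    rw [← integral_finsetSum _ fun m _ => (integrable_pow_mul_cexp (hint _) ξ).const_mul _,
      ← integral_sub (integrable_pow_mul_cexp (hint j) _)
        (integrable_finsetSum _ fun m _ => (integrable_pow_mul_cexp (hint _) ξ).const_mul _)]
    refine integral_congr_ae (ae_of_all _ fun t => ?_)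
    simp only [mul_sub, Finset.mul_sum]
    congr 1
    · rw [mul_assoc ((t : ℂ) ^ j), ← Complex.exp_add]; push_cast; ring_nf
    · refine Finset.sum_congr rfl fun m _ => ?_
      rw [mul_pow (Complex.I * h), pow_add]; ring
  rw [h1, ← integral_const_mul]
  refine norm_integral_le_of_norm_le ((hint _).const_mul _) ?_
  filter_upwards [hpos] with t ht
  have h2 := norm_cexp_mul_sub_sum_le (c := Complex.I * h) (by simp) M ht.le
  rw [norm_mul, norm_mul]
  have h3 : ‖Complex.exp (Complex.I * ξ * t)‖ = 1 := by simp [Complex.norm_exp]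
  have h4 : ‖(t : ℂ) ^ j‖ = t ^ j := by simp [abs_of_pos ht]
  rw [h3, h4, mul_one]
  refine (mul_le_mul_of_nonneg_left h2 (by positivity)).trans_eq ?_
  simp
  ring

/-- The ratio (j+M)!/M! is at most (M+j)ʲ, so the geometric factor 2⁻ᴹ wins. -/
lemma tendsto_taylor_remainder (j : ℕ) {h : ℝ} (hh : |h| ≤ 1 / 2) :
    Tendsto (fun M : ℕ => |h| ^ M / M.factorial * (j + M).factorial) atTop (𝓝 0) := by
  have h1 := (tendsto_pow_const_mul_const_pow_of_abs_lt_one j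
    (r := 1 / 2) (by rw [abs_of_pos] <;> norm_num)).const_mul (2 ^ j)
  have h2 := h1.comp (tendsto_add_atTop_nat j)
  rw [mul_zero] at h2
  refine squeeze_zero (fun M => by positivity) (fun M => ?_) h2
  have h3 : ((j + M).factorial : ℝ) ≤ M.factorial * (M + j : ℕ) ^ j := by
    have := Nat.factorial_mul_ascFactorial M j
    rw [add_comm j M, ← this]
    have h4 : (M + 1).ascFactorial j ≤ (M + j) ^ j := by
      rcases Nat.eq_zero_or_pos j with rfl | hj
      · simp
      · have := Nat.ascFactorial_le_pow_add M j
        simpa using this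
    exact_mod_cast Nat.mul_le_mul_left _ h4
  have h5 : (0 : ℝ) < M.factorial := by positivity
  calc |h| ^ M / M.factorial * (j + M).factorial
      ≤ (1 / 2) ^ M / M.factorial * (M.factorial * (M + j : ℕ) ^ j) := by gcongr
    _ = (1 / 2) ^ M * (M + j : ℕ) ^ j := by field_simp
    _ = _ := by
      simp only [Function.comp, pow_add, one_div]
      have : (2 : ℝ) ^ j * 2⁻¹ ^ j = 1 := by rw [← mul_pow]; simp
      linear_combination (-(2⁻¹ ^ M * (M + j : ℕ) ^ j)) * this

/-- Interchange of limits by an ε/3 argument: the approximation error must be small uniformly for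
large n, where the starting index may depend on M. -/
lemma tendsto_of_uniform_approx {A : ℕ → ℂ} {a : ℂ} {B : ℕ → ℕ → ℂ} {b : ℕ → ℂ} {e : ℕ → ℝ}
    (he : Tendsto e atTop (𝓝 0)) (hB : ∀ M, Tendsto (B M) atTop (𝓝 (b M)))
    (hA : ∀ M, ∀ᶠ n in atTop, ‖A n - B M n‖ ≤ e M) (ha : ∀ M, ‖a - b M‖ ≤ e M) :
    Tendsto A atTop (𝓝 a) := by
  rw [Metric.tendsto_nhds]
  intro ε hε
  obtain ⟨M, hM⟩ := (he.eventually (gt_mem_nhds (show 0 < ε / 3 by positivity))).exists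
  filter_upwards [hA M, Metric.tendsto_nhds.1 (hB M) (ε / 3) (by positivity)] with n h1 h2
  have h3 := ha M
  rw [← dist_eq_norm] at h1 h3
  have h4 := dist_triangle4 (A n) (B M n) (b M) a
  rw [dist_comm (b M) a] at h4
  linarith

section

variable {ν : ℕ → Measure ℝ} {μ : Measure ℝ}

lemma tendsto_momentChar_add (hpos : ∀ n, ∀ᵐ t ∂ν n, 0 < t) (hpos' : ∀ᵐ t ∂μ, 0 < t)
    (hint : ∀ n (j : ℕ), Integrable (fun t : ℝ => t ^ j) (ν n))
    (hint' : ∀ j : ℕ, Integrable (fun t : ℝ => t ^ j) μ)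
    (hmom : ∀ j : ℕ, ∀ᶠ n in atTop, ∫ t, t ^ j ∂ν n = j.factorial)
    (hmom' : ∀ j : ℕ, ∫ t, t ^ j ∂μ = j.factorial) {ξ h : ℝ} (hh : |h| ≤ 1 / 2)
    (H : ∀ j, Tendsto (fun n => momentChar (ν n) j ξ) atTop (𝓝 (momentChar μ j ξ))) (j : ℕ) :
    Tendsto (fun n => momentChar (ν n) j (ξ + h)) atTop (𝓝 (momentChar μ j (ξ + h))) := by
  refine tendsto_of_uniform_approx (tendsto_taylor_remainder j hh)
    (B := fun M n => ∑ m ∈ Finset.range M,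
      (Complex.I * h) ^ m / m.factorial * momentChar (ν n) (j + m) ξ)
    (fun M => tendsto_finsetSum _ fun m _ => (H (j + m)).const_mul _) (fun M => ?_) fun M => ?_
  · filter_upwards [hmom (j + M)] with n hn
    rw [← hn]
    exact norm_momentChar_add_sub_le (hpos n) (hint n) j M ξ h
  · rw [← hmom' (j + M)]
    exact norm_momentChar_add_sub_le hpos' hint' j M ξ h

/-- Convergence at ξ = 0 is convergence of moments, and it spreads in steps of length 1/2, a step
size that does not depend on ξ. All orders j are carried along, because each expansion uses every
higher one. -/
lemma tendsto_momentChar (hpos : ∀ n, ∀ᵐ t ∂ν n, 0 < t) (hpos' : ∀ᵐ t ∂μ, 0 < t)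
    (hint : ∀ n (j : ℕ), Integrable (fun t : ℝ => t ^ j) (ν n))
    (hint' : ∀ j : ℕ, Integrable (fun t : ℝ => t ^ j) μ)
    (hmom : ∀ j : ℕ, ∀ᶠ n in atTop, ∫ t, t ^ j ∂ν n = j.factorial)
    (hmom' : ∀ j : ℕ, ∫ t, t ^ j ∂μ = j.factorial) (N : ℕ) :
    ∀ ξ : ℝ, |ξ| ≤ N / 2 → ∀ j,
      Tendsto (fun n => momentChar (ν n) j ξ) atTop (𝓝 (momentChar μ j ξ)) := by
  induction N with
  | zero =>
    intro ξ hξ j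
    have h0 : ξ = 0 := by simpa using hξ
    subst h0
    have h1 : ∀ ρ : Measure ℝ, momentChar ρ j 0 = ((∫ t, t ^ j ∂ρ : ℝ) : ℂ) := by
      intro ρ
      rw [momentChar, ← integral_complex_ofReal]
      simp
    simp only [h1]
    refine tendsto_const_nhds.congr' ?_
    filter_upwards [hmom j] with n hn
    rw [hn, hmom']
  | succ N ih =>
    intro ξ hξ
    push_cast at hξ
    have hN : (0 : ℝ) < N + 1 := by positivity
    -- The first summand has modulus at most N/2 and the second at most 1/2.
    have e : ξ = ξ * (N / (N + 1)) + ξ / (N + 1) := by field_simp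
    rw [e]
    refine tendsto_momentChar_add hpos hpos' hint hint' hmom hmom' ?_ (ih _ ?_)
    · rw [abs_div, abs_of_pos hN, div_le_iff₀ hN]; linarith
    · rw [abs_mul, abs_of_nonneg (show (0 : ℝ) ≤ N / (N + 1) by positivity), mul_div_assoc',
        div_le_iff₀ hN]
      nlinarith [abs_nonneg ξ, (Nat.cast_nonneg N : (0 : ℝ) ≤ N)]

end

/-! ### Weak convergence of the quadrature measures -/

/-- The discrete measure of Gauss-Laguerre quadrature with `n` nodes. -/
def quadMeasure (n : ℕ) : Measure ℝ :=
  ∑ t ∈ laguerreNodes n, ENNReal.ofReal (laguerreWeight n t) • Measure.dirac t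

lemma integrable_quadMeasure {E : Type*} [NormedAddCommGroup E] (n : ℕ) (f : ℝ → E) :
    Integrable f (quadMeasure n) := by
  rw [quadMeasure, integrable_finsetSum_measure]
  exact fun t _ => (integrable_dirac (by simp)).smul_measure (by simp)

lemma integral_quadMeasure {E : Type*} [NormedAddCommGroup E] [NormedSpace ℝ E] [CompleteSpace E]
    (n : ℕ) (f : ℝ → E) :
    ∫ t, f t ∂quadMeasure n = ∑ t ∈ laguerreNodes n, laguerreWeight n t • f t := by
  rw [quadMeasure, integral_finsetSum_measure
    fun t _ => (integrable_dirac (by simp)).smul_measure (by simp)]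
  refine Finset.sum_congr rfl fun t ht => ?_
  rw [integral_smul_measure, integral_dirac, ENNReal.toReal_ofReal (laguerreWeight_nonneg ht)]

lemma ae_quadMeasure_pos (n : ℕ) : ∀ᵐ t ∂quadMeasure n, 0 < t := by
  rw [quadMeasure, ae_finsetSum_measure_iff]
  intro t ht
  refine Measure.ae_smul_measure ?_ _
  rw [ae_dirac_iff measurableSet_Ioi]
  exact pos_of_mem_laguerreNodes ht

lemma integral_pow_quadMeasure {n j : ℕ} (h : j < 2 * n) :
    ∫ t, t ^ j ∂quadMeasure n = j.factorial := by
  have := sum_laguerreWeight_mul_eval (n := n) (p := X ^ j) (by simpa using h)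
  rw [integral_quadMeasure]
  simpa [integral_pow_erlang] using this

/-- The index is shifted because the rule without nodes is the zero measure. The total mass is the
moment of order 0. -/
instance isProbabilityMeasure_quadMeasure (n : ℕ) : IsProbabilityMeasure (quadMeasure (n + 1)) := by
  have : IsFiniteMeasure (quadMeasure (n + 1)) := by
    simpa using (integrable_const_iff (c := (1 : ℝ))).1 (integrable_quadMeasure (n + 1) _)
  have h := integral_pow_quadMeasure (n := n + 1) (j := 0) (by omega)
  constructor
  simp only [pow_zero, integral_const, smul_eq_mul, mul_one, Nat.factorial_zero, Nat.cast_one] at h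
  rw [Measure.real, ENNReal.toReal_eq_one_iff] at h
  exact h

/-- The exponential law, as an element of the space of probability measures. -/
def exponentialLaw : ProbabilityMeasure ℝ := ⟨erlang 0, inferInstance⟩

/-- Gauss-Laguerre quadrature with `n + 1` nodes, as an element of the space of probability
measures. -/
def quadLaw (n : ℕ) : ProbabilityMeasure ℝ := ⟨quadMeasure (n + 1), inferInstance⟩

lemma coe_exponentialLaw : (exponentialLaw : Measure ℝ) = erlang 0 := rfl

lemma coe_quadLaw (n : ℕ) : (quadLaw n : Measure ℝ) = quadMeasure (n + 1) := rfl

/-- Gauss-Laguerre quadrature converges weakly to the exponential law. -/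
theorem tendsto_quadMeasure :
    Tendsto quadLaw atTop (𝓝 exponentialLaw) := by
  refine ProbabilityMeasure.tendsto_of_tendsto_charFun fun ξ => ?_
  obtain ⟨N, hN⟩ := exists_nat_ge (2 * |ξ|)
  have h := tendsto_momentChar (ν := fun n => quadMeasure (n + 1)) (μ := erlang 0)
    (fun n => ae_quadMeasure_pos _) (ae_erlang_pos 0) (fun n j => integrable_quadMeasure _ _)
    integrable_pow_erlang (fun j => by
      filter_upwards [eventually_ge_atTop j] with n hn
      exact integral_pow_quadMeasure (by omega)) integral_pow_erlang N ξ (by linarith) 0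
  have h1 : ∀ ρ : Measure ℝ, charFun ρ ξ = momentChar ρ 0 ξ := by
    intro ρ
    rw [charFun_apply_real, momentChar]
    refine integral_congr_ae (ae_of_all _ fun t => ?_)
    simp only [pow_zero, one_mul]
    ring_nf
  simpa only [coe_quadLaw, coe_exponentialLaw, h1] using h

/-- The product Gauss-Laguerre rule converges on bounded functions that are continuous on the
closed quadrant. -/
theorem tendsto_sum_laguerreWeight_prod {f : ℝ × ℝ → ℝ} {C : ℝ} (hC : ∀ x, |f x| ≤ C)
    (hf : ContinuousOn f (Set.Ici 0 ×ˢ Set.Ici 0)) :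
    Tendsto (fun SD : ℕ × ℕ => ∑ s ∈ laguerreNodes SD.1, ∑ d ∈ laguerreNodes SD.2,
      laguerreWeight SD.1 s * (laguerreWeight SD.2 d * f (s, d))) atTop
      (𝓝 (∫ s, ∫ d, f (s, d) ∂erlang 0 ∂erlang 0)) := by
  -- Clamping both coordinates at 0 extends the function continuously to the plane. All measures
  -- involved live on the open quadrant, where nothing changes.
  let g : BoundedContinuousFunction (ℝ × ℝ) ℝ :=
    BoundedContinuousFunction.ofNormedAddCommGroup (fun x => f (max x.1 0, max x.2 0))
      (hf.comp_continuous (by fun_prop) fun x =>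
        Set.mk_mem_prod (le_max_right x.1 0) (le_max_right x.2 0)) C
      fun x => hC _
  have hprod := (ProbabilityMeasure.continuous_prod (α := ℝ) (β := ℝ)).tendsto
    (exponentialLaw, exponentialLaw)
  have h2 := hprod.comp ((tendsto_quadMeasure.comp tendsto_fst).prodMk_nhds
    (tendsto_quadMeasure.comp tendsto_snd))
  rw [← prod_atTop_atTop_eq]
  have h3 := (ProbabilityMeasure.tendsto_iff_forall_integral_tendsto.1 h2) g
  have hg : ∀ {s d : ℝ}, 0 < s → 0 < d → g (s, d) = f (s, d) := by
    intro s d hs hd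
    simp [g, max_eq_left hs.le, max_eq_left hd.le]
  have h4 : ∫ x, g x ∂((erlang 0).prod (erlang 0)) = ∫ s, ∫ d, f (s, d) ∂erlang 0 ∂erlang 0 := by
    rw [integral_prod _ (g.integrable _)]
    refine integral_congr_ae ?_
    filter_upwards [ae_erlang_pos 0] with s hs
    refine integral_congr_ae ?_
    filter_upwards [ae_erlang_pos 0] with d hd
    exact hg hs hd
  have h5 : ∀ S D : ℕ, ∫ x, g x ∂((quadMeasure (S + 1)).prod (quadMeasure (D + 1))) =
      ∑ s ∈ laguerreNodes (S + 1), ∑ d ∈ laguerreNodes (D + 1),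
      laguerreWeight (S + 1) s * (laguerreWeight (D + 1) d * f (s, d)) := by
    intro S D
    rw [integral_prod _ (g.integrable _), integral_quadMeasure]
    refine Finset.sum_congr rfl fun s hs => ?_
    rw [integral_quadMeasure, smul_eq_mul, Finset.mul_sum]
    refine Finset.sum_congr rfl fun d hd => ?_
    rw [hg (pos_of_mem_laguerreNodes hs) (pos_of_mem_laguerreNodes hd), smul_eq_mul]
  -- This undoes the index shift in `quadLaw`.
  have h6 := h3.comp (((tendsto_sub_atTop_nat 1).comp tendsto_fst).prodMk
    ((tendsto_sub_atTop_nat 1).comp tendsto_snd))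
  simp only [Function.comp_def, ProbabilityMeasure.toMeasure_prod, coe_quadLaw,
    coe_exponentialLaw] at h6
  rw [h4] at h6
  refine h6.congr' ?_
  filter_upwards [(eventually_ge_atTop 1).prod_mk (eventually_ge_atTop 1)] with SD hSD
  obtain ⟨S, D⟩ := SD
  obtain ⟨hS, hD⟩ := hSD
  simp only at hS hD
  rw [h5, Nat.sub_add_cancel hS, Nat.sub_add_cancel hD]


/-! ### The function B and the Bessel integral -/

lemma expNegInvGlue_le_one (x : ℝ) : expNegInvGlue x ≤ 1 := by
  unfold expNegInvGlue
  split_ifs with h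
  · exact zero_le_one
  · push Not at h
    exact Real.exp_le_one_iff.2 (by simpa using h.le)

lemma continuous_expNegInvGlue : Continuous expNegInvGlue :=
  (expNegInvGlue.contDiff (n := 0)).continuous

/-- `bracket (n + 1) x⁻¹` for `0 ≤ x`, written as a probability. -/
def bracketInv (n : ℕ) (x : ℝ) : ℝ := 1 - ∫ y, expNegInvGlue (x * y) ∂erlang n

lemma integrable_expNegInvGlue_mul (n : ℕ) (x : ℝ) :
    Integrable (fun y => expNegInvGlue (x * y)) (erlang n) := by
  have hc := continuous_expNegInvGlue
  refine (integrable_const (1 : ℝ)).mono' (by fun_prop) (ae_of_all _ fun y => ?_)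
  rw [Real.norm_of_nonneg (expNegInvGlue.nonneg _)]
  exact expNegInvGlue_le_one _

/-- Working with the inverse argument keeps continuity at 0, that is, where a_k - η ν_k vanishes.
The hypothesis on t > 0 does not exclude this at t = 0. There `expNegInvGlue` supplies the limit
value of exp(-1/x). -/
lemma continuous_bracketInv (n : ℕ) : Continuous (bracketInv n) := by
  have hc := continuous_expNegInvGlue
  refine continuous_const.sub (continuous_of_dominated (bound := fun _ => 1) (fun x => by fun_prop)
    (fun x => ae_of_all _ fun y => ?_) (integrable_const _) (ae_of_all _ fun y => by fun_prop))
  rw [Real.norm_of_nonneg (expNegInvGlue.nonneg _)]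
  exact expNegInvGlue_le_one _

lemma bracketInv_mem_Icc (n : ℕ) (x : ℝ) : bracketInv n x ∈ Set.Icc 0 1 := by
  have h0 : 0 ≤ ∫ y, expNegInvGlue (x * y) ∂erlang n :=
    integral_nonneg fun y => expNegInvGlue.nonneg _
  have h1 : ∫ y, expNegInvGlue (x * y) ∂erlang n ≤ ∫ _, (1 : ℝ) ∂erlang n :=
    integral_mono (integrable_expNegInvGlue_mul n x) (integrable_const _)
      fun y => expNegInvGlue_le_one _
  simp only [integral_const, probReal_univ, smul_eq_mul, mul_one] at h1
  constructor <;> simp only [bracketInv] <;> linarith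

lemma image_mul_exp {r : ℝ} (hr : 0 < r) :
    (fun t : ℝ => r * Real.exp t) '' Set.univ = Set.Ioi 0 := by
  ext y
  simp only [Set.image_univ, Set.mem_range, Set.mem_Ioi]
  constructor
  · rintro ⟨t, rfl⟩; positivity
  · intro hy
    exact ⟨Real.log (y / r), by rw [Real.exp_log (by positivity)]; field_simp⟩

/-- Substituting y = √X eᵗ turns y + X/y into 2√X cosh t. Averaging the integral over the whole line
with its reflection t ↦ -t then replaces e^((n+1)t) by cosh((n+1)t), which is even. -/
lemma integral_pow_mul_exp_add_inv (n : ℕ) {X : ℝ} (hX : 0 < X) :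
    ∫ y in Set.Ioi 0, y ^ n * Real.exp (-y) * Real.exp (-(X / y)) =
      2 * √X ^ (n + 1) * besselK ((n + 1 : ℕ) : ℝ) (2 * √X) := by
  set r := √X with hr
  have hr0 : 0 < r := Real.sqrt_pos.2 hX
  have hrr : r * r = X := Real.mul_self_sqrt hX.le
  set F : ℝ → ℝ := fun y => y ^ n * Real.exp (-y) * Real.exp (-(X / y)) with hF
  have hFi : IntegrableOn F (Set.Ioi 0) := by
    refine (integrableOn_pow_mul_exp_neg n).mono' (by fun_prop) ?_
    filter_upwards [ae_restrict_mem measurableSet_Ioi] with y hy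
    have hy' : (0 : ℝ) < y := hy
    have : Real.exp (-(X / y)) ≤ 1 := Real.exp_le_one_iff.2 (by simp; positivity)
    rw [Real.norm_of_nonneg (by positivity)]
    exact mul_le_of_le_one_right (by positivity) this
  have hd : ∀ t ∈ Set.univ, HasDerivWithinAt (fun t : ℝ => r * Real.exp t) (r * Real.exp t)
      Set.univ t := fun t _ => ((Real.hasDerivAt_exp t).const_mul r).hasDerivWithinAt
  have hinj : Set.InjOn (fun t : ℝ => r * Real.exp t) Set.univ := by
    intro a _ b _ hab
    exact Real.exp_injective (mul_left_cancel₀ hr0.ne' hab)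
  have key : ∀ t : ℝ, |r * Real.exp t| • F (r * Real.exp t) =
      r ^ (n + 1) * (Real.exp (((n + 1 : ℕ) : ℝ) * t) * Real.exp (-(2 * r) * Real.cosh t)) := by
    intro t
    have h1 : Real.exp (((n + 1 : ℕ) : ℝ) * t) = Real.exp t ^ (n + 1) := Real.exp_nat_mul t (n + 1)
    have h2 : Real.exp (-(2 * r) * Real.cosh t) =
        Real.exp (-(r * Real.exp t)) * Real.exp (-(X / (r * Real.exp t))) := by
      rw [← Real.exp_add, Real.cosh_eq, ← hrr, Real.exp_neg]
      congr 1
      field_simp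
      ring
    rw [abs_of_pos (by positivity), h1, h2, hF, smul_eq_mul]
    simp only
    ring
  have hint := (integrableOn_image_iff_integrableOn_abs_deriv_smul MeasurableSet.univ hd hinj F).1
    (by rwa [image_mul_exp hr0])
  have hval := integral_image_eq_integral_abs_deriv_smul MeasurableSet.univ hd hinj F
  rw [image_mul_exp hr0] at hval
  simp only [key, Measure.restrict_univ, integrableOn_univ] at hint hval
  rw [hval, integral_const_mul]
  have hint' : Integrable fun t : ℝ =>
      Real.exp (((n + 1 : ℕ) : ℝ) * t) * Real.exp (-(2 * r) * Real.cosh t) := by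
    have := hint.const_mul ((r ^ (n + 1))⁻¹)
    refine this.congr (ae_of_all _ fun t => ?_)
    have : r ^ (n + 1) ≠ 0 := by positivity
    field_simp
  have hneg := hint'.comp_neg
  have hneg2 := integral_neg_eq_self (fun t : ℝ =>
      Real.exp (((n + 1 : ℕ) : ℝ) * t) * Real.exp (-(2 * r) * Real.cosh t)) volume
  have hsum := integral_add hint' hneg
  rw [hneg2] at hsum
  have habs := integral_comp_abs (f := fun t : ℝ =>
    Real.exp (-(2 * r) * Real.cosh t) * Real.cosh (((n + 1 : ℕ) : ℝ) * t))
  have h3 : ∀ t : ℝ, Real.exp (((n + 1 : ℕ) : ℝ) * t) * Real.exp (-(2 * r) * Real.cosh t) +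
      Real.exp (((n + 1 : ℕ) : ℝ) * -t) * Real.exp (-(2 * r) * Real.cosh (-t)) =
      2 * (Real.exp (-(2 * r) * Real.cosh |t|) * Real.cosh (((n + 1 : ℕ) : ℝ) * |t|)) := by
    intro t
    have h4 : Real.cosh (((n + 1 : ℕ) : ℝ) * |t|) = Real.cosh (((n + 1 : ℕ) : ℝ) * t) := by
      rw [← Real.cosh_abs (((n + 1 : ℕ) : ℝ) * t), abs_mul, Nat.abs_cast]
    rw [h4, Real.cosh_abs, Real.cosh_neg, Real.cosh_eq (((n + 1 : ℕ) : ℝ) * t), mul_neg]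
    ring
  simp only [h3, integral_const_mul, habs] at hsum
  rw [besselK]
  linear_combination (-(r ^ (n + 1)) / 2) * hsum

lemma bracket_inv (n : ℕ) {x : ℝ} (hx : 0 ≤ x) : bracket (n + 1) x⁻¹ = bracketInv n x := by
  rcases hx.eq_or_lt with rfl | hx
  -- With `0⁻¹ = 0` both sides equal 1: the power of 0 vanishes on the left, and `expNegInvGlue 0 =
  -- 0` on the right.
  · have : ((n : ℝ) + 1) / 2 ≠ 0 := by positivity
    simp [bracket, bracketInv, Real.zero_rpow this]
  have hX : 0 < x⁻¹ := by positivity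
  have h := integral_pow_mul_exp_add_inv n hX
  have h1 : ∫ y, expNegInvGlue (x * y) ∂erlang n =
      (n.factorial : ℝ)⁻¹ * ∫ y in Set.Ioi 0, y ^ n * Real.exp (-y) * Real.exp (-(x⁻¹ / y)) := by
    rw [integral_erlang, ← integral_const_mul]
    refine setIntegral_congr_fun measurableSet_Ioi (fun y hy => ?_)
    have hy' : 0 < x * y := mul_pos hx hy
    simp only [expNegInvGlue, not_le.2 hy', if_false, smul_eq_mul]
    rw [mul_inv, div_eq_mul_inv x⁻¹]
    ring
  have h2 : x⁻¹ ^ (((n + 1 : ℕ) : ℝ) / 2) = √(x⁻¹) ^ (n + 1) := by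
    rw [Real.sqrt_eq_rpow, ← Real.rpow_natCast, ← Real.rpow_mul hX.le]
    congr 1
    ring
  have h3 : Real.Gamma ((n + 1 : ℕ) : ℝ) = n.factorial := by
    push_cast; exact Real.Gamma_nat_eq_factorial n
  rw [bracket, bracketInv, h1, h, h2, h3]
  ring


/-! ### Erlang laws as sums of exponentials -/

section Erlang

lemma charFun_erlang_eq (n : ℕ) (ξ : ℝ) : charFun (erlang n) ξ =
    ∫ t in Set.Ioi (0 : ℝ), (t : ℂ) ^ n / n.factorial * Complex.exp (-(1 - ξ * Complex.I) * t) := by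
  rw [charFun_apply_real, integral_erlang]
  refine setIntegral_congr_fun measurableSet_Ioi (fun t _ => ?_)
  simp only [Complex.real_smul]
  push_cast
  rw [mul_assoc, ← Complex.exp_add]
  ring_nf

lemma norm_cexp_neg_one_sub_mul (ξ t : ℝ) :
    ‖Complex.exp (-(1 - ξ * Complex.I) * t)‖ = Real.exp (-t) := by
  simp [Complex.norm_exp]

lemma integrableOn_charFun_erlang (n : ℕ) (ξ : ℝ) : IntegrableOn (fun t : ℝ =>
    (t : ℂ) ^ n / n.factorial * Complex.exp (-(1 - ξ * Complex.I) * t)) (Set.Ioi 0) := by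
  refine ((integrableOn_pow_mul_exp_neg n).div_const (n.factorial : ℝ)).mono'
    (by fun_prop) ?_
  filter_upwards [ae_restrict_mem measurableSet_Ioi] with t ht
  have ht' : (0 : ℝ) < t := ht
  rw [norm_mul, norm_cexp_neg_one_sub_mul]
  simp only [norm_div, norm_pow, Complex.norm_real, Complex.norm_natCast,
    Real.norm_of_nonneg ht'.le]
  exact le_of_eq (by ring)

/-- Integration by parts lowers n by one at the cost of a factor 1 - iξ; the antiderivative vanishes
at 0 and at infinity. -/
lemma charFun_erlang_mul (n : ℕ) (ξ : ℝ) :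
    charFun (erlang n) ξ * (1 - ξ * Complex.I) ^ (n + 1) = 1 := by
  have hz : (1 - (ξ : ℂ) * Complex.I) ≠ 0 := by
    intro h
    simpa using congrArg Complex.re h
  induction n with
  | zero =>
    rw [charFun_erlang_eq]
    have h := integral_exp_mul_complex_Ioi (a := -(1 - (ξ : ℂ) * Complex.I)) (by simp) 0
    simp only [pow_zero, Nat.factorial_zero, Nat.cast_one, div_one, one_mul, zero_add, pow_one]
    rw [h]
    have h2 : -(1 - (ξ : ℂ) * Complex.I) ≠ 0 := neg_ne_zero.2 hz
    simp only [Complex.ofReal_zero, mul_zero, Complex.exp_zero]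
    rw [neg_div_neg_eq, one_div, inv_mul_cancel₀ hz]
  | succ n ih =>
    suffices h : charFun (erlang (n + 1)) ξ * (1 - ξ * Complex.I) = charFun (erlang n) ξ by
      rw [pow_succ', ← mul_assoc, h, ih]
    set z := 1 - (ξ : ℂ) * Complex.I with hzdef
    have hd : ∀ t ∈ Set.Ici (0 : ℝ), HasDerivAt
        (fun t : ℝ => (t : ℂ) ^ (n + 1) / (n + 1).factorial * Complex.exp (-z * t))
        ((t : ℂ) ^ n / n.factorial * Complex.exp (-z * t) -
          ((t : ℂ) ^ (n + 1) / (n + 1).factorial * Complex.exp (-z * t)) * z) t := by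
      intro t _
      have h0 : HasDerivAt (fun x : ℝ => (x : ℂ)) 1 t := (hasDerivAt_id t).ofReal_comp
      have h1 : HasDerivAt (fun x : ℝ => -z * (x : ℂ)) (-z) t := by
        simpa using h0.const_mul (-z)
      convert! ((h0.pow (n + 1)).div_const ((n + 1).factorial : ℂ)).mul h1.cexp using 1
      have h3 : (n.factorial : ℂ) ≠ 0 := by exact_mod_cast n.factorial_ne_zero
      have h4 : ((n : ℂ) + 1) ≠ 0 := by exact_mod_cast n.succ_ne_zero
      simp only [Nat.factorial_succ, Nat.add_sub_cancel, Pi.pow_apply]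
      push_cast
      field_simp
      ring
    have hlim : Tendsto (fun t : ℝ => (t : ℂ) ^ (n + 1) / (n + 1).factorial *
        Complex.exp (-z * t)) atTop (𝓝 0) := by
      rw [tendsto_zero_iff_norm_tendsto_zero]
      have h1 := (Real.tendsto_pow_mul_exp_neg_atTop_nhds_zero (n + 1)).div_const
        ((n + 1).factorial : ℝ)
      rw [zero_div] at h1
      refine h1.congr' ?_
      filter_upwards [eventually_ge_atTop 0] with t ht
      rw [norm_mul, norm_cexp_neg_one_sub_mul]
      simp only [norm_div, norm_pow, Complex.norm_real, Complex.norm_natCast,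
        Real.norm_of_nonneg ht]
      ring
    have hi1 := integrableOn_charFun_erlang n ξ
    have hi2 := (integrableOn_charFun_erlang (n + 1) ξ).mul_const z
    have h := integral_Ioi_of_hasDerivAt_of_tendsto' hd (hi1.sub hi2) hlim
    rw [integral_sub hi1 hi2, integral_mul_const, ← charFun_erlang_eq, ← charFun_erlang_eq] at h
    simp only [Complex.ofReal_zero, ne_eq, Nat.add_eq_zero_iff, one_ne_zero, and_false,
      not_false_eq_true, zero_pow, zero_div, zero_mul, sub_zero] at h
    exact (sub_eq_zero.1 h).symm

/-- The sum of `n + 1` independent exponential variables has the Erlang law. -/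
lemma map_sum_pi_erlang (n : ℕ) :
    (Measure.pi fun _ : Fin (n + 1) => erlang 0).map (fun t => ∑ q, t q) = erlang n := by
  have : IsProbabilityMeasure
      ((Measure.pi fun _ : Fin (n + 1) => erlang 0).map (fun t => ∑ q, t q)) :=
    Measure.isProbabilityMeasure_map (by fun_prop)
  refine Measure.ext_of_charFun (funext fun ξ => ?_)
  have hz : (1 - (ξ : ℂ) * Complex.I) ≠ 0 := by
    intro h
    simpa using congrArg Complex.re h
  have h1 : charFun ((Measure.pi fun _ : Fin (n + 1) => erlang 0).map (fun t => ∑ q, t q)) ξ =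
      charFun (erlang 0) ξ ^ (n + 1) := by
    rw [charFun_apply_real, integral_map (by fun_prop) (by fun_prop)]
    have h2 : ∀ t : Fin (n + 1) → ℝ, Complex.exp (ξ * ((∑ q, t q : ℝ) : ℂ) * Complex.I) =
        ∏ q, Complex.exp (ξ * (t q : ℂ) * Complex.I) := by
      intro t
      rw [← Complex.exp_sum, Complex.ofReal_sum, Finset.mul_sum, Finset.sum_mul]
    simp only [h2]
    rw [integral_fintype_prod_eq_pow (fun t : ℝ => Complex.exp (ξ * (t : ℂ) * Complex.I)),
      Fintype.card_fin, charFun_apply_real]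
  have h2 := charFun_erlang_mul n ξ
  have h3 := charFun_erlang_mul 0 ξ
  rw [h1]
  refine mul_right_cancel₀ (pow_ne_zero (n + 1) hz) ?_
  rw [h2, ← mul_pow]
  simp only [zero_add, pow_one] at h3
  rw [h3, one_pow]

lemma measureReal_erlang_zero_Iio {a : ℝ} (ha : 0 ≤ a) :
    (erlang 0).real (Set.Iio a) = 1 - Real.exp (-a) := by
  have h : (erlang 0).real (Set.Ici a) = Real.exp (-a) := by
    rw [← setIntegral_one_eq_measureReal, ← integral_indicator measurableSet_Ici, integral_erlang]
    have h1 : ∀ t : ℝ, (t ^ 0 / (0 : ℕ).factorial * Real.exp (-t)) •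
        (Set.Ici a).indicator (fun _ => (1 : ℝ)) t =
        (Set.Ici a).indicator (fun t => Real.exp (-t)) t := by
      intro t
      by_cases ht : t ∈ Set.Ici a <;> simp [ht]
    simp only [h1]
    rw [integral_indicator measurableSet_Ici, Measure.restrict_restrict measurableSet_Ici,
      ← integral_exp_neg_Ioi a]
    refine setIntegral_congr_set ?_
    have h2 : Set.Ioi a = Set.Ioi a ∩ Set.Ioi (0 : ℝ) :=
      (Set.inter_eq_left.2 (Set.Ioi_subset_Ioi ha)).symm
    rw [h2]
    exact (Ioi_ae_eq_Ici.symm).inter (ae_eq_refl _)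
  rw [← Set.compl_Ici, probReal_compl_eq_one_sub measurableSet_Ici, h]

lemma integrable_id_erlang (n : ℕ) : Integrable (fun t : ℝ => t) (erlang n) := by
  rw [integrable_erlang_iff]
  refine ((integrableOn_pow_mul_exp_neg (n + 1)).div_const (n.factorial : ℝ)).congr
    (ae_of_all _ fun t => ?_)
  simp only [smul_eq_mul]
  ring

lemma integral_id_erlang (n : ℕ) : ∫ t, t ∂erlang n = n + 1 := by
  rw [integral_erlang]
  have h : ∀ t : ℝ, (t ^ n / n.factorial * Real.exp (-t)) • t =
      (t ^ (n + 1) * Real.exp (-t)) / n.factorial := fun t => by simp only [smul_eq_mul]; ring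
  simp only [h]
  rw [integral_div, integral_pow_mul_exp_neg, Nat.factorial_succ]
  have : (n.factorial : ℝ) ≠ 0 := by positivity
  push_cast
  field_simp

end Erlang

/-! ### Complex Gaussian vectors -/

section ComplexGaussian

instance isProbabilityMeasure_complexGaussian (N : ℝ) :
    IsProbabilityMeasure (complexGaussian N) :=
  Measure.isProbabilityMeasure_map (by fun_prop)

lemma charFun_complexGaussian {N : ℝ} (hN : 0 ≤ N) (ξ : ℂ) :
    charFun (complexGaussian N) ξ = Complex.exp ((-(N * ‖ξ‖ ^ 2 / 4) : ℝ)) := by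
  rw [charFun_apply, complexGaussian, integral_map (by fun_prop) (by fun_prop)]
  have h : ∀ x : ℝ × ℝ, Complex.exp ((inner ℝ (Complex.measurableEquivRealProd.symm x) ξ : ℝ) *
      Complex.I) = Complex.exp (ξ.re * x.1 * Complex.I) * Complex.exp (ξ.im * x.2 * Complex.I) := by
    intro x
    rw [← Complex.exp_add, Complex.inner, Complex.measurableEquivRealProd_symm_apply]
    congr 1
    simp
    ring
  simp only [h]
  rw [integral_prod_mul (fun x : ℝ => Complex.exp (ξ.re * x * Complex.I))
    (fun x : ℝ => Complex.exp (ξ.im * x * Complex.I)), ← charFun_apply_real, ← charFun_apply_real,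
    charFun_gaussianReal, charFun_gaussianReal, ← Complex.exp_add]
  have h2 : (((N / 2).toNNReal : ℝ) : ℂ) = N / 2 := by
    rw [Real.coe_toNNReal _ (by positivity)]; push_cast; rfl
  rw [h2, ← Complex.normSq_eq_norm_sq, Complex.normSq_apply]
  congr 1
  push_cast
  ring

/-- Independence factors the characteristic function; moving conj(c) across the real inner product
scales each frequency ξ to c ξ. -/
lemma map_sum_star_mul_complexGaussian {m : ℕ} {N : ℝ} (hN : 0 ≤ N) (c : Fin m → ℂ) :
    (Measure.pi fun _ : Fin m => complexGaussian N).map (fun z => ∑ q, star (c q) * z q) =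
      complexGaussian (N * ∑ q, ‖c q‖ ^ 2) := by
  have hm : Measurable (fun z : Fin m → ℂ => ∑ q, star (c q) * z q) :=
    Finset.measurable_sum _ fun q _ => (measurable_pi_apply q).const_mul _
  have : IsProbabilityMeasure
      ((Measure.pi fun _ : Fin m => complexGaussian N).map (fun z => ∑ q, star (c q) * z q)) :=
    Measure.isProbabilityMeasure_map hm.aemeasurable
  refine Measure.ext_of_charFun (funext fun ξ => ?_)
  rw [charFun_complexGaussian (by positivity), charFun_apply,
    integral_map hm.aemeasurable (by fun_prop)]
  have h : ∀ z : Fin m → ℂ, Complex.exp ((inner ℝ (∑ q, star (c q) * z q) ξ : ℝ) * Complex.I) =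
      ∏ q, Complex.exp ((inner ℝ (z q) (c q * ξ) : ℝ) * Complex.I) := by
    intro z
    rw [← Complex.exp_sum, sum_inner, Complex.ofReal_sum, Finset.sum_mul]
    congr 1
    refine Finset.sum_congr rfl fun q _ => ?_
    rw [Complex.inner, Complex.inner, map_mul, RCLike.star_def, Complex.conj_conj]
    congr 3
    ring
  simp only [h]
  rw [integral_fintype_prod_eq_prod
    (fun q (z : ℂ) => Complex.exp ((inner ℝ z (c q * ξ) : ℝ) * Complex.I))]
  simp only [← charFun_apply, charFun_complexGaussian hN]
  rw [← Complex.exp_sum, ← Complex.ofReal_sum]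
  congr 2
  simp only [norm_mul, mul_pow]
  rw [Finset.sum_neg_distrib, ← Finset.sum_div, Finset.mul_sum, Finset.sum_mul]
  congr 2
  refine Finset.sum_congr rfl fun q _ => ?_
  ring

lemma gaussianPDF_mul_gaussianPDF (r θ : ℝ) :
    gaussianPDF 0 (1 / 2 : ℝ).toNNReal (r * Real.cos θ) *
      gaussianPDF 0 (1 / 2 : ℝ).toNNReal (r * Real.sin θ) =
      ENNReal.ofReal (Real.pi⁻¹ * Real.exp (-r ^ 2)) := by
  rw [gaussianPDF, gaussianPDF, ← ENNReal.ofReal_mul (gaussianPDFReal_nonneg _ _ _),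
    gaussianPDFReal, gaussianPDFReal, Real.coe_toNNReal _ (by norm_num)]
  congr 1
  have h1 : 2 * Real.pi * (1 / 2) = Real.pi := by ring
  have h2 : (√Real.pi)⁻¹ * (√Real.pi)⁻¹ = Real.pi⁻¹ := by
    rw [← mul_inv, Real.mul_self_sqrt Real.pi_pos.le]
  have h3 : Real.exp (-r ^ 2) = Real.exp (-(r * Real.cos θ - 0) ^ 2 / (2 * (1 / 2))) *
      Real.exp (-(r * Real.sin θ - 0) ^ 2 / (2 * (1 / 2))) := by
    rw [← Real.exp_add]
    congr 1
    linear_combination (r ^ 2) * Real.sin_sq_add_cos_sq θ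
  rw [h1, h3, ← h2]
  ring

lemma image_sq_Ioi : (fun r : ℝ => r ^ 2) '' Set.Ioi 0 = Set.Ioi 0 := by
  ext y
  simp only [Set.mem_image, Set.mem_Ioi]
  constructor
  · rintro ⟨r, hr, rfl⟩; positivity
  · intro hy
    exact ⟨√y, Real.sqrt_pos.2 hy, Real.sq_sqrt hy.le⟩

/-- In polar coordinates the density is π⁻¹ exp(-r²) r dr dθ. The angle contributes 2π, and u = r²
leaves e⁻ᵘ du. -/
lemma map_norm_sq_complexGaussian_one :
    (complexGaussian 1).map (fun z => ‖z‖ ^ 2) = erlang 0 := by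
  refine Measure.ext_of_lintegral _ fun f hf => ?_
  have hv : (1 / 2 : ℝ).toNNReal ≠ 0 := by simp
  rw [lintegral_map hf (by fun_prop), complexGaussian, lintegral_map (by fun_prop) (by fun_prop),
    gaussianReal_of_var_ne_zero 0 hv,
    prod_withDensity (measurable_gaussianPDF _ _) (measurable_gaussianPDF _ _),
    lintegral_withDensity_eq_lintegral_mul _ (by fun_prop) (by fun_prop),
    ← Measure.volume_eq_prod, ← lintegral_comp_polarCoord_symm]
  have h1 : ∀ p : ℝ × ℝ, ENNReal.ofReal p.1 • ((fun z : ℝ × ℝ =>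
      gaussianPDF 0 (1 / 2 : ℝ).toNNReal z.1 * gaussianPDF 0 (1 / 2 : ℝ).toNNReal z.2) *
      fun a => f (‖Complex.measurableEquivRealProd.symm a‖ ^ 2)) (polarCoord.symm p) =
      (fun p : ℝ × ℝ => ENNReal.ofReal p.1 * (ENNReal.ofReal (Real.pi⁻¹ * Real.exp (-p.1 ^ 2)) *
        f (p.1 ^ 2))) p := by
    intro p
    have h2 : ‖Complex.measurableEquivRealProd.symm (polarCoord.symm p)‖ ^ 2 = p.1 ^ 2 := by
      rw [Complex.measurableEquivRealProd_symm_polarCoord_symm_apply, Complex.norm_polarCoord_symm,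
        sq_abs]
    have h3 := gaussianPDF_mul_gaussianPDF p.1 p.2
    simp only [Pi.mul_apply, smul_eq_mul, h2]
    rw [← h3]
    rfl
  simp only [h1]
  rw [polarCoord_target, Measure.volume_eq_prod, ← Measure.prod_restrict,
    lintegral_prod _ (by fun_prop), lintegral_erlang 0 f hf]
  conv_rhs => rw [← image_sq_Ioi,
    lintegral_image_eq_lintegral_abs_deriv_mul measurableSet_Ioi
      (f' := fun r => 2 * r) (fun r _ => by
        simpa using (hasDerivAt_pow 2 r).hasDerivWithinAt)
      (fun a ha b hb hab => by
        have ha' : (0 : ℝ) < a := ha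
        have hb' : (0 : ℝ) < b := hb
        exact (sq_eq_sq₀ ha'.le hb'.le).1 hab)]
  refine setLIntegral_congr_fun measurableSet_Ioi fun r hr => ?_
  have hr' : (0 : ℝ) < r := hr
  simp only [lintegral_const, MeasurableSet.univ, Measure.restrict_apply, Set.univ_inter,
    Real.volume_Ioo, abs_of_pos (show 0 < 2 * r by positivity)]
  rw [← mul_assoc, ← mul_assoc, ← ENNReal.ofReal_mul hr'.le, mul_right_comm,
    ← ENNReal.ofReal_mul (by positivity), ← ENNReal.ofReal_mul (by positivity)]
  congr 2
  have := Real.pi_ne_zero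
  field_simp
  simp
  ring

lemma map_norm_sq_complexGaussian {N : ℝ} (hN : 0 ≤ N) :
    (complexGaussian N).map (fun z => ‖z‖ ^ 2) = (erlang 0).map (fun t => N * t) := by
  have h := map_sum_star_mul_complexGaussian (m := 1) zero_le_one (fun _ => ((√N : ℝ) : ℂ))
  have h2 : (1 : ℝ) * ∑ _q : Fin 1, ‖((√N : ℝ) : ℂ)‖ ^ 2 = N := by
    simp [Real.sq_sqrt hN, abs_of_nonneg]
  rw [h2] at h
  have h3 : (Measure.pi fun _ : Fin 1 => complexGaussian 1).map (fun z => z 0) =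
      complexGaussian 1 := (measurePreserving_eval (fun _ : Fin 1 => complexGaussian 1) 0).map_eq
  have hm : Measurable (fun z : Fin 1 → ℂ => ∑ q, star (((√N : ℝ) : ℂ)) * z q) :=
    Finset.measurable_sum _ fun q _ => (measurable_pi_apply q).const_mul _
  have h4 := congrArg (Measure.map fun z : ℂ => ‖z‖ ^ 2) h3
  rw [Measure.map_map (by fun_prop) (by fun_prop), map_norm_sq_complexGaussian_one] at h4
  rw [← h, ← h4, Measure.map_map (by fun_prop) (by fun_prop),
    Measure.map_map (by fun_prop) (by fun_prop)]
  congr 1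
  funext z
  simp [mul_pow, Real.sq_sqrt hN]

lemma map_sum_norm_sq_complexGaussian (n : ℕ) {N : ℝ} (hN : 0 ≤ N) :
    (Measure.pi fun _ : Fin (n + 1) => complexGaussian N).map (fun z => ∑ q, ‖z q‖ ^ 2) =
      (erlang n).map (fun t => N * t) := by
  have hp : IsProbabilityMeasure ((complexGaussian N).map (fun z => ‖z‖ ^ 2)) :=
    Measure.isProbabilityMeasure_map (by fun_prop)
  have hp' : IsProbabilityMeasure ((erlang 0).map (fun t => N * t)) :=
    Measure.isProbabilityMeasure_map (by fun_prop)
  have h1 := Measure.pi_map_pi (μ := fun _ : Fin (n + 1) => complexGaussian N)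
    (f := fun _ z => ‖z‖ ^ 2) (fun _ => by fun_prop)
  have h2 := Measure.pi_map_pi (μ := fun _ : Fin (n + 1) => erlang 0)
    (f := fun _ t => N * t) (fun _ => by fun_prop)
  rw [map_norm_sq_complexGaussian hN, ← h2] at h1
  have h3 := congrArg (Measure.map (fun t : Fin (n + 1) → ℝ => ∑ q, t q)) h1
  rw [Measure.map_map (by fun_prop) (by fun_prop), Measure.map_map (by fun_prop) (by fun_prop)]
    at h3
  rw [← map_sum_pi_erlang n, Measure.map_map (by fun_prop) (by fun_prop)]
  refine Eq.trans h3 ?_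
  congr 1
  funext t
  simp [Finset.mul_sum]

end ComplexGaussian


/-! ### The law of the cascaded gain -/

/-- The common law of the cascaded channel gains: `N` times the product of independent variables
of law `erlang n` and `erlang 0`. -/
def gainLaw (n : ℕ) (N : ℝ) : Measure ℝ :=
  ((erlang n).prod (erlang 0)).map (fun x => N * (x.1 * x.2))

instance isProbabilityMeasure_gainLaw (n : ℕ) (N : ℝ) : IsProbabilityMeasure (gainLaw n N) :=
  Measure.isProbabilityMeasure_map (by fun_prop)

lemma lintegral_gainLaw (n : ℕ) (N : ℝ) {f : ℝ → ℝ≥0∞} (hf : Measurable f) :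
    ∫⁻ x, f x ∂gainLaw n N = ∫⁻ y, ∫⁻ t, f (N * (y * t)) ∂erlang 0 ∂erlang n := by
  rw [gainLaw, lintegral_map hf (by fun_prop), lintegral_prod _ (by fun_prop)]

lemma integrable_id_gainLaw (n : ℕ) (N : ℝ) : Integrable (fun x => x) (gainLaw n N) := by
  rw [gainLaw, integrable_map_measure (by fun_prop) (by fun_prop)]
  exact ((integrable_id_erlang n).mul_prod (integrable_id_erlang 0)).const_mul N

lemma integral_id_gainLaw (n : ℕ) (N : ℝ) : ∫ x, x ∂gainLaw n N = (n + 1) * N := by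
  rw [gainLaw, integral_map (by fun_prop) (by fun_prop), integral_const_mul,
    integral_prod_mul (fun y : ℝ => y) (fun t : ℝ => t), integral_id_erlang, integral_id_erlang]
  push_cast
  ring

/-- Given the Erlang factor y, the exponential factor lies below x/(N y) with probability 1 -
exp(-x/(N y)); then average over y. -/
lemma measureReal_gainLaw_Iio (n : ℕ) {N x : ℝ} (hN : 0 < N) (hx : 0 < x) :
    (gainLaw n N).real (Set.Iio x) = bracketInv n (N / x) := by
  rw [gainLaw, map_measureReal_apply (by fun_prop) measurableSet_Iio,
    ← setIntegral_one_eq_measureReal, ← integral_indicator (by measurability), integral_prod]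
  · have h : ∀ᵐ y ∂erlang n, ∫ t, ((fun x : ℝ × ℝ => N * (x.1 * x.2)) ⁻¹' Set.Iio x).indicator
        (fun _ => (1 : ℝ)) (y, t) ∂erlang 0 = 1 - expNegInvGlue (N / x * y) := by
      filter_upwards [ae_erlang_pos n] with y hy
      have h1 : ∀ t : ℝ, ((fun x : ℝ × ℝ => N * (x.1 * x.2)) ⁻¹' Set.Iio x).indicator
          (fun _ => (1 : ℝ)) (y, t) = (Set.Iio (x / (N * y))).indicator (fun _ => (1 : ℝ)) t := by
        intro t
        have h2 : N * (y * t) < x ↔ t < x / (N * y) := by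
          rw [lt_div_iff₀ (by positivity)]; ring_nf
        simp only [Set.indicator, Set.mem_preimage, Set.mem_Iio, h2]
      simp only [h1]
      have hpos : 0 < N / x * y := by positivity
      rw [integral_indicator measurableSet_Iio, setIntegral_one_eq_measureReal,
        measureReal_erlang_zero_Iio (by positivity), expNegInvGlue, if_neg (not_le.2 hpos)]
      congr 3
      field_simp
    rw [integral_congr_ae h, integral_sub (integrable_const _) (integrable_expNegInvGlue_mul n _)]
    simp [bracketInv]
  · exact (integrable_const (1 : ℝ)).indicator (by measurability)

lemma map_pair_of_iIndepFun_sum {Ω α : Type*} [MeasurableSpace Ω] {μ : Measure Ω}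
    [IsProbabilityMeasure μ] {ι κ : Type*} [Fintype ι] [Fintype κ] [MeasurableSpace α]
    {X : ι → Ω → α} {Y : κ → Ω → α} (hX : ∀ i, AEMeasurable (X i) μ)
    (hY : ∀ i, AEMeasurable (Y i) μ) (h : iIndepFun (Sum.elim X Y) μ) :
    μ.map (fun ω => ((fun i => X i ω), (fun i => Y i ω))) =
      (Measure.pi fun i => μ.map (X i)).prod (Measure.pi fun i => μ.map (Y i)) := by
  have hm : ∀ i, AEMeasurable (Sum.elim X Y i) μ := by
    rintro (i | i)
    · exact hX i
    · exact hY i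
  have hp : ∀ i, IsProbabilityMeasure (μ.map (Sum.elim X Y i)) :=
    fun i => Measure.isProbabilityMeasure_map (hm i)
  have h1 := (iIndepFun_iff_map_fun_eq_pi_map hm).1 h
  have h2 := (measurePreserving_sumPiEquivProdPi (fun i => μ.map (Sum.elim X Y i))).map_eq
  rw [← h1, AEMeasurable.map_map_of_aemeasurable (by fun_prop) (by fun_prop)] at h2
  exact h2

/-- The p-th column of I ⊗ 1 is the indicator of the p-th block. -/
lemma cascade_eq_sum {P Q : ℕ} (p : Fin P) (hbr hr : Fin P × Fin Q → ℂ) :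
    cascade p hbr hr = ∑ q, star (hr (p, q)) * hbr (p, q) := by
  simp only [cascade, onOffMatrix, dotProduct, Matrix.mulVec_diagonal, Fintype.sum_prod_type,
    Pi.star_apply, Matrix.kroneckerMap_apply, Matrix.of_apply, mul_one, Matrix.one_apply]
  rw [Finset.sum_eq_single p]
  · simp
  · intro b _ hb
    simp [hb]
  · simp

lemma measurable_cascadeGain_fun (m : ℕ) : Measurable
    (fun x : (Fin m → ℂ) × (Fin m → ℂ) => ‖∑ q, star (x.2 q) * x.1 q‖ ^ 2) := by
  refine (Measurable.norm (Finset.measurable_sum _ fun q _ => ?_)).pow_const 2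
  refine Measurable.mul ?_ (by fun_prop)
  exact continuous_star.measurable.comp (by fun_prop)

lemma cascadeGain_eq_comp {Ω : Type*} {P n : ℕ} {hbr hr : Fin P × Fin (n + 1) → Ω → ℂ}
    (p : Fin P) : cascadeGain p hbr hr =
    (fun x : (Fin (n + 1) → ℂ) × (Fin (n + 1) → ℂ) => ‖∑ q, star (x.2 q) * x.1 q‖ ^ 2) ∘
      (fun ω => ((fun q => hbr (p, q) ω), (fun q => hr (p, q) ω))) := by
  funext ω
  simp [cascadeGain, cascade_eq_sum]

lemma aemeasurable_cascadeGain {Ω : Type*} [MeasurableSpace Ω] {μ : Measure Ω} {P n : ℕ}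
    {hbr hr : Fin P × Fin (n + 1) → Ω → ℂ} (p : Fin P) (h1 : ∀ m, AEMeasurable (hbr m) μ)
    (h2 : ∀ m, AEMeasurable (hr m) μ) : AEMeasurable (cascadeGain p hbr hr) μ := by
  rw [cascadeGain_eq_comp]
  exact (measurable_cascadeGain_fun _).comp_aemeasurable (by fun_prop)

/-- With h_r frozen at w, the inner sum is complex Gaussian with variance N ‖w‖², so its squared
modulus is N ‖w‖² times a unit exponential. -/
lemma map_cascadeGain {Ω : Type*} [MeasurableSpace Ω] {μ : Measure Ω} [IsProbabilityMeasure μ]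
    {P n : ℕ} {N N' : ℝ} {hbr hr : Fin P × Fin (n + 1) → Ω → ℂ} (p : Fin P) (hN : 0 ≤ N) (hN' : 0 ≤ N')
    (hbr_law : ∀ m, HasLaw (hbr m) (complexGaussian N) μ)
    (hr_law : ∀ m, HasLaw (hr m) (complexGaussian N') μ)
    (h_indep : iIndepFun (Sum.elim hbr hr) μ) :
    μ.map (cascadeGain p hbr hr) = gainLaw n (N * N') := by
  have hm1 : ∀ m, AEMeasurable (hbr m) μ := fun m => (hbr_law m).aemeasurable
  have hm2 : ∀ m, AEMeasurable (hr m) μ := fun m => (hr_law m).aemeasurable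
  have hind : iIndepFun (Sum.elim (fun q => hbr (p, q)) (fun q => hr (p, q))) μ := by
    have := h_indep.precomp (g := Sum.map (fun q => (p, q)) (fun q => (p, q)))
      (Function.Injective.sumMap (Prod.mk_right_injective p) (Prod.mk_right_injective p))
    convert! this using 1
    funext i
    cases i <;> rfl
  have hpair := map_pair_of_iIndepFun_sum (fun q => hm1 (p, q)) (fun q => hm2 (p, q)) hind
  simp only [fun m => (hbr_law m).map_eq, fun m => (hr_law m).map_eq] at hpair
  have hmeas := measurable_cascadeGain_fun (n + 1)
  rw [cascadeGain_eq_comp, ← AEMeasurable.map_map_of_aemeasurable hmeas.aemeasurable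
    (by fun_prop), hpair]
  refine Measure.ext_of_lintegral _ fun f hf => ?_
  rw [lintegral_map hf hmeas, lintegral_prod_symm _ (by fun_prop), lintegral_gainLaw _ _ hf]
  have key : ∀ w : Fin (n + 1) → ℂ, ∫⁻ z, f (‖∑ q, star (w q) * z q‖ ^ 2)
      ∂(Measure.pi fun _ : Fin (n + 1) => complexGaussian N) =
      ∫⁻ t, f (N * (∑ q, ‖w q‖ ^ 2) * t) ∂erlang 0 := by
    intro w
    have hm : Measurable (fun z : Fin (n + 1) → ℂ => ∑ q, star (w q) * z q) :=
      Finset.measurable_sum _ fun q _ => (measurable_pi_apply q).const_mul _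
    have hw : 0 ≤ N * ∑ q, ‖w q‖ ^ 2 := by positivity
    rw [← lintegral_map (f := fun u : ℂ => f (‖u‖ ^ 2)) (by fun_prop) hm,
      map_sum_star_mul_complexGaussian hN, ← lintegral_map (f := f) hf (by fun_prop),
      map_norm_sq_complexGaussian hw, lintegral_map hf (by fun_prop)]
  simp only [key]
  -- The remaining integrand depends on w only through its squared norm, which is N' times an Erlang
  -- variable.
  rw [← lintegral_map (f := fun y : ℝ => ∫⁻ t, f (N * y * t) ∂erlang 0)
    (g := fun w : Fin (n + 1) → ℂ => ∑ q, ‖w q‖ ^ 2)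
    (Measurable.lintegral_prod_right (by fun_prop)) (by fun_prop),
    map_sum_norm_sq_complexGaussian n hN',
    lintegral_map (Measurable.lintegral_prod_right (by fun_prop)) (by fun_prop)]
  refine lintegral_congr fun y => lintegral_congr fun t => ?_
  congr 1
  ring


/-! ### Order statistics -/

lemma orderStat_lt_iff {K : ℕ} (v : Fin K → ℝ) (k : Fin K) (x : ℝ) :
    orderStat v k < x ↔ (k : ℕ) + 1 ≤ (Finset.univ.filter fun i => v i < x).card := by
  have hmono : Monotone (v ∘ Tuple.sort v) := Tuple.monotone_sort v
  have hcard : (Finset.univ.filter fun i => v i < x).card =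
      (Finset.univ.filter fun j => v (Tuple.sort v j) < x).card :=
    (Finset.card_equiv (Tuple.sort v) (by simp)).symm
  rw [hcard, orderStat]
  constructor
  · intro h
    have hsub : Finset.Iic k ⊆ Finset.univ.filter fun j => v (Tuple.sort v j) < x := by
      intro j hj
      simp only [Finset.mem_filter, Finset.mem_univ, true_and]
      exact (hmono (Finset.mem_Iic.1 hj)).trans_lt h
    simpa using Finset.card_le_card hsub
  · intro h
    by_contra! hx
    have hsub : (Finset.univ.filter fun j => v (Tuple.sort v j) < x) ⊆ Finset.Iio k := by
      intro j hj
      simp only [Finset.mem_filter, Finset.mem_univ, true_and] at hj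
      rw [Finset.mem_Iio]
      by_contra! hkj
      exact absurd (hx.trans (hmono hkj)) (not_le.2 hj)
    have := Finset.card_le_card hsub
    simp only [Fin.card_Iio] at this
    omega

/-- The distribution function of the order statistic of rank `r` among `K` independent variables,
as a function of their common distribution function. -/
def orderCdf (K r : ℕ) (u : ℝ) : ℝ :=
  kappa K r * ∑ l ∈ Finset.range (K - r + 1),
    ((K - r).choose l : ℝ) * (-1 : ℝ) ^ l / ((r : ℝ) + (l : ℝ)) * u ^ (r + l)

lemma eq_of_derivative_eq {p q : ℝ[X]} (h : derivative p = derivative q)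
    (h0 : p.eval 0 = q.eval 0) : p = q := by
  have h1 : derivative (p - q) = 0 := by rw [derivative_sub, h, sub_self]
  have h2 := eq_C_of_natDegree_eq_zero (Polynomial.derivative_eq_zero.1 h1)
  rw [coeff_zero_eq_eval_zero, eval_sub, h0, sub_self, C_0] at h2
  exact sub_eq_zero.1 h2

/-- Both sides vanish at 0 and have derivative κ Xᵏ (1 - X)^(K-k-1). On the left the derivatives of
the Bernstein polynomials telescope; on the right the binomial theorem resums the terms. -/
lemma sum_bernsteinPolynomial_tail {K k : ℕ} (hk : k < K) :
    ∑ j ∈ Finset.Ico (k + 1) (K + 1), bernsteinPolynomial ℝ K j =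
      C (kappa K (k + 1)) * ∑ l ∈ Finset.range (K - (k + 1) + 1),
        C (((K - (k + 1)).choose l : ℝ) * (-1) ^ l / (((k + 1 : ℕ) : ℝ) + l)) *
          X ^ (k + 1 + l) := by
  obtain ⟨m, rfl⟩ : ∃ m, K = k + 1 + m := ⟨K - (k + 1), by omega⟩
  rw [Finset.sum_Ico_eq_sum_range, show k + 1 + m + 1 - (k + 1) = m + 1 by omega,
    Nat.add_sub_cancel_left]
  refine eq_of_derivative_eq ?_ ?_
  · have hB : ∀ j ∈ Finset.range (m + 1), derivative (bernsteinPolynomial ℝ (k + 1 + m) (k + 1 + j))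
        = ((k + 1 + m : ℕ) : ℝ[X]) * (bernsteinPolynomial ℝ (k + m) (k + j) -
          bernsteinPolynomial ℝ (k + m) (k + (j + 1))) := by
      intro j _
      have := bernsteinPolynomial.derivative_succ ℝ (k + 1 + m) (k + j)
      rw [show k + 1 + m - 1 = k + m by omega] at this
      rw [show k + 1 + j = k + j + 1 by omega, this]
      rfl
    rw [derivative_sum, Finset.sum_congr rfl hB, ← Finset.mul_sum,
      Finset.sum_range_sub' (fun j => bernsteinPolynomial ℝ (k + m) (k + j)),
      bernsteinPolynomial.eq_zero_of_lt ℝ (show k + m < k + (m + 1) by omega), sub_zero, add_zero,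
      bernsteinPolynomial, Nat.add_sub_cancel_left, derivative_C_mul, derivative_sum]
    have hd : ∀ l ∈ Finset.range (m + 1), derivative
        (C ((m.choose l : ℝ) * (-1) ^ l / (((k + 1 : ℕ) : ℝ) + l)) * X ^ (k + 1 + l)) =
        X ^ k * ((-X) ^ l * 1 ^ (m - l) * (m.choose l : ℝ[X])) := by
      intro l _
      rw [derivative_C_mul_X_pow, show k + 1 + l - 1 = k + l by omega, neg_pow (X : ℝ[X]), pow_add]
      have h1 : ((m.choose l : ℝ) * (-1) ^ l / (((k + 1 : ℕ) : ℝ) + l)) * ((k + 1 + l : ℕ) : ℝ) =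
          (-1) ^ l * (m.choose l : ℝ) := by
        have : (((k + 1 : ℕ) : ℝ) + l) ≠ 0 := by positivity
        push_cast at this ⊢
        field_simp
      rw [h1]
      simp only [map_mul, map_pow, map_neg, map_one, map_natCast]
      ring
    rw [Finset.sum_congr rfl hd, ← Finset.mul_sum, ← add_pow]
    have hκ : kappa (k + 1 + m) (k + 1) = ((k + 1 + m : ℕ) : ℝ) * ((k + m).choose k : ℝ) := by
      have h1 : (k + m).choose k * k.factorial * m.factorial = (k + m).factorial := by
        have := Nat.choose_mul_factorial_mul_factorial (Nat.le_add_right k m)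
        simpa using this
      have h2 : (k + 1 + m).factorial = (k + 1 + m) * (k + m).factorial := by
        rw [show k + 1 + m = k + m + 1 by omega, Nat.factorial_succ]
      rw [kappa, Nat.add_sub_cancel_left, Nat.add_sub_cancel, h2, ← h1]
      have h3 : (k.factorial : ℝ) ≠ 0 := by positivity
      have h4 : (m.factorial : ℝ) ≠ 0 := by positivity
      push_cast
      field_simp
    rw [hκ, map_mul, map_natCast, map_natCast]
    ring
  · simp only [eval_finsetSum, eval_mul, eval_C, eval_pow, eval_X]
    rw [Finset.sum_eq_zero, Finset.sum_eq_zero, mul_zero]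
    · intro l _
      simp
    · intro j _
      simp [bernsteinPolynomial]

/-- Split according to the set T of indices below x. The cells are disjoint boxes whose mass depends
only on the size of T. -/
lemma measureReal_pi_card_lt (K m : ℕ) (ρ : Measure ℝ) [IsProbabilityMeasure ρ] (x : ℝ) :
    (Measure.pi fun _ : Fin K => ρ).real
      {v | m ≤ (Finset.univ.filter fun i => v i < x).card} =
      ∑ j ∈ Finset.Ico m (K + 1),
        (K.choose j : ℝ) * ρ.real (Set.Iio x) ^ j * (1 - ρ.real (Set.Iio x)) ^ (K - j) := by
  classical
  set F := ρ.real (Set.Iio x) with hF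
  let A : Finset (Fin K) → Set (Fin K → ℝ) :=
    fun T => Set.univ.pi fun i => if i ∈ T then Set.Iio x else Set.Ici x
  have hA : ∀ T v, v ∈ A T ↔ (Finset.univ.filter fun i => v i < x) = T := by
    intro T v
    simp only [A, Set.mem_univ_pi, Finset.ext_iff, Finset.mem_filter, Finset.mem_univ, true_and]
    refine forall_congr' fun i => ?_
    by_cases hi : i ∈ T <;> simp [hi]
  have hAm : ∀ T, MeasurableSet (A T) := fun T =>
    MeasurableSet.univ_pi fun i => by split_ifs <;> measurability
  have hset : {v : Fin K → ℝ | m ≤ (Finset.univ.filter fun i => v i < x).card} =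
      ⋃ T ∈ Finset.univ.powerset.filter (fun T : Finset (Fin K) => m ≤ T.card), A T := by
    ext v
    simp [hA]
  have hdisj : Set.PairwiseDisjoint
      (↑(Finset.univ.powerset.filter (fun T : Finset (Fin K) => m ≤ T.card))) A := by
    intro S _ T _ hST
    refine Set.disjoint_left.2 fun v hS hT => hST ?_
    rw [← (hA S v).1 hS, ← (hA T v).1 hT]
  have hprob : ∀ T, (Measure.pi fun _ : Fin K => ρ).real (A T) =
      F ^ T.card * (1 - F) ^ (K - T.card) := by
    intro T
    rw [measureReal_def, Measure.pi_pi, ENNReal.toReal_prod]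
    have h1 : ∀ i : Fin K, (ρ (if i ∈ T then Set.Iio x else Set.Ici x)).toReal =
        if i ∈ T then F else 1 - F := by
      intro i
      split_ifs
      · rfl
      · rw [← measureReal_def, ← Set.compl_Iio, probReal_compl_eq_one_sub measurableSet_Iio]
    simp only [h1]
    rw [Finset.prod_ite]
    simp only [Finset.prod_const, Finset.filter_mem_eq_inter, Finset.univ_inter]
    congr 2
    rw [Finset.filter_not, Finset.filter_mem_eq_inter, Finset.univ_inter,
      Finset.card_sdiff_of_subset (Finset.subset_univ T), Finset.card_univ, Fintype.card_fin]
  rw [hset, measureReal_biUnion_finset hdisj (fun T _ => hAm T)]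
  simp only [hprob]
  rw [Finset.sum_filter]
  have h := Finset.sum_powerset_apply_card
    (fun j => if m ≤ j then F ^ j * (1 - F) ^ (K - j) else 0) (x := (Finset.univ : Finset (Fin K)))
  rw [h, Finset.card_univ, Fintype.card_fin]
  have hI : Finset.Ico m (K + 1) = (Finset.range (K + 1)).filter (fun j => m ≤ j) := by
    ext j
    simp only [Finset.mem_Ico, Finset.mem_filter, Finset.mem_range]
    omega
  rw [hI, Finset.sum_filter]
  refine Finset.sum_congr rfl fun j _ => ?_
  split_ifs
  · rw [nsmul_eq_mul, mul_assoc]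
  · simp

lemma measureReal_pi_card_lt_eq_orderCdf {K : ℕ} (k : Fin K) (ρ : Measure ℝ)
    [IsProbabilityMeasure ρ] (x : ℝ) :
    (Measure.pi fun _ : Fin K => ρ).real
      {v | (k : ℕ) + 1 ≤ (Finset.univ.filter fun i => v i < x).card} =
      orderCdf K (k + 1) (ρ.real (Set.Iio x)) := by
  have h := congrArg (Polynomial.eval (ρ.real (Set.Iio x))) (sum_bernsteinPolynomial_tail k.2)
  simp only [eval_finsetSum, eval_mul, eval_C, eval_pow, eval_X, bernsteinPolynomial, eval_sub,
    eval_one, eval_natCast] at h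
  rw [measureReal_pi_card_lt, h, orderCdf]

lemma continuous_orderCdf (K r : ℕ) : Continuous (orderCdf K r) := by
  unfold orderCdf
  fun_prop


lemma measurable_card_lt {α : Type*} [MeasurableSpace α] {K : ℕ} {v : α → Fin K → ℝ} {T : α → ℝ}
    (hv : Measurable v) (hT : Measurable T) :
    Measurable fun x => (Finset.univ.filter fun i => v x i < T x).card := by
  simp only [Finset.card_filter]
  refine Finset.measurable_sum _ fun i _ => Measurable.ite ?_ measurable_const measurable_const
  exact measurableSet_lt ((measurable_pi_apply i).comp hv) hT

/-- The distribution of an order statistic relative to a threshold that depends on two independent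
exponential variables. -/
lemma measureReal_card_lt_threshold {Ω : Type*} [MeasurableSpace Ω] {μ : Measure Ω}
    [IsProbabilityMeasure μ] {K : ℕ} (k : Fin K) {G : Fin K → Ω → ℝ} {Y : Fin 2 → Ω → ℝ}
    {ρ : Measure ℝ} [IsProbabilityMeasure ρ] {c₀ c₁ : ℝ} (hG : ∀ i, AEMeasurable (G i) μ)
    (hY : ∀ j, AEMeasurable (Y j) μ) (hGρ : ∀ i, μ.map (G i) = ρ)
    (hY0 : μ.map (Y 0) = (erlang 0).map (fun t => c₀ * t))
    (hY1 : μ.map (Y 1) = (erlang 0).map (fun t => c₁ * t))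
    (hind : iIndepFun (Sum.elim G Y) μ) {T : ℝ × ℝ → ℝ} (hT : Measurable T) :
    μ.real {ω | (k : ℕ) + 1 ≤ (Finset.univ.filter fun i => G i ω < T (Y 0 ω, Y 1 ω)).card} =
      ∫ s, ∫ d, orderCdf K (k + 1) (ρ.real (Set.Iio (T (c₀ * d, c₁ * s)))) ∂erlang 0 ∂erlang 0 := by
  have hpY : ∀ j, IsProbabilityMeasure (μ.map (Y j)) :=
    fun j => Measure.isProbabilityMeasure_map (hY j)
  have hjoint := map_pair_of_iIndepFun_sum hG hY hind
  simp only [hGρ] at hjoint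
  have htwo : (Measure.pi fun j => μ.map (Y j)).map (fun y => (y 0, y 1)) =
      ((erlang 0).prod (erlang 0)).map (fun x => (c₀ * x.1, c₁ * x.2)) := by
    have h1 := (measurePreserving_piFinTwo (fun j => μ.map (Y j))).map_eq
    rw [hY0, hY1, Measure.map_prod_map _ _ (by fun_prop) (by fun_prop)] at h1
    exact h1
  have hpair : μ.map (fun ω => ((fun i => G i ω), (Y 0 ω, Y 1 ω))) =
      ((Measure.pi fun _ : Fin K => ρ).prod ((erlang 0).prod (erlang 0))).map
        (fun x => (x.1, (c₀ * x.2.1, c₁ * x.2.2))) := by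
    have h1 := congrArg (Measure.map (Prod.map id (fun y : Fin 2 → ℝ => (y 0, y 1)))) hjoint
    rw [AEMeasurable.map_map_of_aemeasurable (by fun_prop) (by fun_prop),
      ← Measure.map_prod_map _ _ (by fun_prop) (by fun_prop), htwo,
      Measure.map_prod_map _ _ (by fun_prop) (by fun_prop)] at h1
    exact h1
  let B : Set ((Fin K → ℝ) × (ℝ × ℝ)) :=
    {x | (k : ℕ) + 1 ≤ (Finset.univ.filter fun i => x.1 i < T x.2).card}
  have hB : MeasurableSet B := measurableSet_le measurable_const
    (measurable_card_lt measurable_fst (hT.comp measurable_snd))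
  have h1 : μ.real {ω | (k : ℕ) + 1 ≤
      (Finset.univ.filter fun i => G i ω < T (Y 0 ω, Y 1 ω)).card} =
      (μ.map (fun ω => ((fun i => G i ω), (Y 0 ω, Y 1 ω)))).real B := by
    rw [measureReal_def, measureReal_def, Measure.map_apply_of_aemeasurable (by fun_prop) hB]
    rfl
  rw [h1, hpair, map_measureReal_apply (by fun_prop) hB, ← setIntegral_one_eq_measureReal]
  have hm : Measurable (fun x : (Fin K → ℝ) × (ℝ × ℝ) => (x.1, (c₀ * x.2.1, c₁ * x.2.2))) := by
    fun_prop
  have hB' := hm hB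
  have hint : Integrable (((fun x : (Fin K → ℝ) × (ℝ × ℝ) =>
      (x.1, (c₀ * x.2.1, c₁ * x.2.2))) ⁻¹' B).indicator (fun _ => (1 : ℝ)))
      ((Measure.pi fun _ : Fin K => ρ).prod ((erlang 0).prod (erlang 0))) :=
    (integrable_const (1 : ℝ)).indicator hB'
  -- Two applications of Fubini put the eavesdropper's variable s outermost, then the user's d, with
  -- the user gains innermost; this matches the order of the sums over s and d.
  rw [← integral_indicator hB', integral_prod_symm _ hint,
    integral_prod_symm _ hint.integral_prod_right]
  refine integral_congr_ae (ae_of_all _ fun s => integral_congr_ae (ae_of_all _ fun d => ?_))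
  simp only
  rw [← measureReal_pi_card_lt_eq_orderCdf, ← setIntegral_one_eq_measureReal,
    ← integral_indicator]
  · rfl
  · exact measurableSet_le measurable_const (measurable_card_lt measurable_id measurable_const)

/-! ### The outage event and the closed forms -/

namespace SystemParams

variable {K : ℕ} (θ : SystemParams K)

lemma ν_nonneg (k : Fin K) : 0 ≤ θ.ν k := Finset.sum_nonneg fun i _ => θ.a_nonneg i

lemma sinrEve_nonneg (k : Fin K) {z y : ℝ} (hz : 0 ≤ z) (hy : 0 ≤ y) : 0 ≤ θ.sinrEve k z y := by
  have := θ.ν_nonneg k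
  have := θ.a_nonneg k
  have := θ.ρe_pos
  have := θ.ϖ_nonneg
  unfold sinrEve
  positivity

lemma sinrUser_nonneg (k : Fin K) {x y : ℝ} (hx : 0 ≤ x) (hy : 0 ≤ y) :
    0 ≤ θ.sinrUser k x y := by
  have := θ.ν_nonneg k
  have := θ.a_nonneg k
  have := θ.ρ_pos
  have := θ.ϖ_nonneg
  unfold sinrUser
  positivity

/-- The smallest SINR of the user `k` that avoids a secrecy outage. -/
def sinrTarget (k : Fin K) (R z y : ℝ) : ℝ := (2 : ℝ) ^ R * (1 + θ.sinrEve k z y) - 1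

lemma sinrTarget_pos (k : Fin K) {R z y : ℝ} (hR : 0 < R) (hz : 0 ≤ z) (hy : 0 ≤ y) :
    0 < θ.sinrTarget k R z y := by
  have h1 : (1 : ℝ) < 2 ^ R := Real.one_lt_rpow (by norm_num) hR
  have h2 := θ.sinrEve_nonneg k hz hy
  unfold sinrTarget
  nlinarith

lemma sinrTarget_mean (Q : ℕ) (k : Fin K) (R t : ℝ) :
    θ.sinrTarget k R (Q * θ.Nbr * θ.Nre) (θ.Nipe * t) = θ.η Q k R t := by
  unfold sinrTarget sinrEve η
  ring_nf

/-- As R > 0, the positive part is irrelevant; exponentiating bounds the SINR by its target. The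
resulting inequality is linear in x after clearing denominators, and `hden` fixes the sign of its
coefficient. -/
lemma secrecyRate_lt_iff (k : Fin K) {R x z yu ye : ℝ} (hR : 0 < R) (hx : 0 ≤ x) (hz : 0 ≤ z)
    (hyu : 0 ≤ yu) (hye : 0 ≤ ye) (hden : θ.sinrTarget k R z ye * θ.ν k < θ.a k) :
    θ.secrecyRate k x z yu ye < R ↔
      x < θ.sinrTarget k R z ye * (θ.ϖ * θ.ρ * yu + 1) /
        (θ.ρ * (θ.a k - θ.sinrTarget k R z ye * θ.ν k)) := by
  have hν := θ.ν_nonneg k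
  have hρ := θ.ρ_pos
  have hϖ := θ.ϖ_nonneg
  have hA : 0 < 1 + θ.sinrUser k x yu := by linarith [θ.sinrUser_nonneg k hx hyu]
  have hB : 0 < 1 + θ.sinrEve k z ye := by linarith [θ.sinrEve_nonneg k hz hye]
  have h2R : (0 : ℝ) < 2 ^ R := by positivity
  have hlog : Real.logb 2 ((2 : ℝ) ^ R * (1 + θ.sinrEve k z ye)) =
      R + Real.logb 2 (1 + θ.sinrEve k z ye) := by
    rw [Real.logb_mul h2R.ne' hB.ne', Real.logb_rpow (by norm_num) (by norm_num)]
  rw [secrecyRate, max_lt_iff, and_iff_left hR, sub_lt_iff_lt_add, ← hlog,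
    Real.logb_lt_logb_iff (by norm_num) hA (by positivity), ← lt_sub_iff_add_lt']
  change θ.sinrUser k x yu < θ.sinrTarget k R z ye ↔ _
  have hd : 0 < θ.ρ * (θ.a k - θ.sinrTarget k R z ye * θ.ν k) := mul_pos hρ (by linarith)
  rw [sinrUser, div_lt_iff₀ (by positivity), lt_div_iff₀ hd]
  constructor <;> intro h <;> nlinarith

/-- The inverse of the argument of `bracket` in the closed form. -/
def invArg (Q : ℕ) (k : Fin K) (R s d : ℝ) : ℝ :=
  (θ.a k - θ.η Q k R s * θ.ν k) / (θ.η Q k R s * θ.ζ₁ k d)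

lemma η_pos (Q : ℕ) (k : Fin K) {R t : ℝ} (hR : 0 < R) (ht : 0 ≤ t) : 0 < θ.η Q k R t := by
  have := θ.Nbr_pos
  have := θ.Nre_pos
  have := θ.Nipe_pos
  rw [← sinrTarget_mean]
  exact θ.sinrTarget_pos k hR (by positivity) (by positivity)

lemma ζ₁_pos (k : Fin K) {t : ℝ} (ht : 0 ≤ t) : 0 < θ.ζ₁ k t := by
  have := θ.Nbr_pos
  have := θ.Nr_pos k
  have := θ.Nipu_pos
  have := θ.ϖ_nonneg
  have := θ.ρ_pos
  unfold ζ₁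
  positivity

lemma continuousOn_η (Q : ℕ) (k : Fin K) (R : ℝ) : ContinuousOn (θ.η Q k R) (Set.Ici 0) := by
  have := θ.Nbr_pos
  have := θ.Nre_pos
  have := θ.Nipe_pos
  have := θ.ϖ_nonneg
  have := θ.ρe_pos
  have := θ.ν_nonneg k
  unfold η
  refine (continuousOn_const.mul (continuousOn_const.add (continuousOn_const.div (by fun_prop)
    fun t ht => ?_))).sub continuousOn_const
  have ht' : (0 : ℝ) ≤ t := ht
  positivity

lemma continuous_ζ₁ (k : Fin K) : Continuous (θ.ζ₁ k) := by
  unfold ζ₁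
  fun_prop

/-- The denominator is now η ζ₁, which is positive on the whole closed quadrant. -/
lemma continuousOn_invArg (Q : ℕ) (k : Fin K) {R : ℝ} (hR : 0 < R) :
    ContinuousOn (fun x : ℝ × ℝ => θ.invArg Q k R x.1 x.2) (Set.Ici 0 ×ˢ Set.Ici 0) := by
  have h1 : ContinuousOn (fun x : ℝ × ℝ => θ.η Q k R x.1) (Set.Ici 0 ×ˢ Set.Ici 0) :=
    (θ.continuousOn_η Q k R).comp continuousOn_fst fun x hx => hx.1
  have h2 : ContinuousOn (fun x : ℝ × ℝ => θ.ζ₁ k x.2) (Set.Ici 0 ×ˢ Set.Ici 0) :=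
    ((θ.continuous_ζ₁ k).comp continuous_snd).continuousOn
  refine (continuousOn_const.sub (h1.mul continuousOn_const)).div (h1.mul h2) fun x hx => ?_
  exact (mul_pos (θ.η_pos Q k hR hx.1) (θ.ζ₁_pos k hx.2)).ne'

lemma bracket_closedForm {n : ℕ} {k : Fin K} {R s d : ℝ} (hR : 0 < R) (hs : 0 ≤ s) (hd : 0 ≤ d)
    (hden : θ.η (n + 1) k R s * θ.ν k < θ.a k) :
    bracket (n + 1) (θ.η (n + 1) k R s * θ.ζ₁ k d / (θ.a k - θ.η (n + 1) k R s * θ.ν k)) =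
      bracketInv n (θ.invArg (n + 1) k R s d) := by
  rw [← bracket_inv, invArg, inv_div]
  exact div_nonneg (by linarith) (mul_pos (θ.η_pos _ k hR hs) (θ.ζ₁_pos k hd)).le

lemma ipsicSum_eq_sum {n : ℕ} {k : Fin K} {R : ℝ} (hR : 0 < R)
    (hden : ∀ t : ℝ, 0 < t → θ.η (n + 1) k R t * θ.ν k < θ.a k) (S D : ℕ) :
    θ.ipsicSum (n + 1) k R S D = ∑ s ∈ laguerreNodes S, ∑ d ∈ laguerreNodes D,
      laguerreWeight S s * (laguerreWeight D d *
        orderCdf K (k + 1) (bracketInv n (θ.invArg (n + 1) k R s d))) := by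
  rw [ipsicSum]
  refine Finset.sum_congr rfl fun s hs => ?_
  rw [Finset.sum_comm]
  refine Finset.sum_congr rfl fun d hd => ?_
  have hs' := pos_of_mem_laguerreNodes hs
  have hd' := pos_of_mem_laguerreNodes hd
  rw [θ.bracket_closedForm hR hs'.le hd'.le (hden s hs'), orderCdf, Finset.mul_sum,
    Finset.mul_sum, Finset.mul_sum]
  refine Finset.sum_congr rfl fun l _ => ?_
  ring

lemma tendsto_ipsicSum {n : ℕ} {k : Fin K} {R : ℝ} (hR : 0 < R)
    (hden : ∀ t : ℝ, 0 < t → θ.η (n + 1) k R t * θ.ν k < θ.a k) :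
    Tendsto (fun SD : ℕ × ℕ => θ.ipsicSum (n + 1) k R SD.1 SD.2) atTop
      (𝓝 (∫ s, ∫ d, orderCdf K (k + 1) (bracketInv n (θ.invArg (n + 1) k R s d))
        ∂erlang 0 ∂erlang 0)) := by
  simp only [θ.ipsicSum_eq_sum hR hden]
  have hcont := continuous_orderCdf K (k + 1)
  obtain ⟨C, hC⟩ := (isCompact_Icc (a := (0 : ℝ)) (b := 1)).exists_bound_of_continuousOn
    hcont.continuousOn
  exact tendsto_sum_laguerreWeight_prod
    (f := fun x => orderCdf K (k + 1) (bracketInv n (θ.invArg (n + 1) k R x.1 x.2)))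
    (fun x => hC _ (bracketInv_mem_Icc n _))
    ((hcont.comp (continuous_bracketInv n)).comp_continuousOn (θ.continuousOn_invArg _ k hR))

lemma η_of_perfect (h : θ.ϖ = 0) (Q : ℕ) (k : Fin K) (R t : ℝ) : θ.η Q k R t = θ.ψ Q k R := by
  simp [η, ψ, h]

lemma ζ₁_of_perfect (h : θ.ϖ = 0) (k : Fin K) (t : ℝ) : θ.ζ₁ k t = (θ.ζ₂ k)⁻¹ := by
  simp [ζ₁, ζ₂, h]

lemma integral_eq_psicSum {n : ℕ} {k : Fin K} {R : ℝ} (hR : 0 < R)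
    (hden : ∀ t : ℝ, 0 < t → θ.η (n + 1) k R t * θ.ν k < θ.a k) (h : θ.ϖ = 0) :
    ∫ s, ∫ d, orderCdf K (k + 1) (bracketInv n (θ.invArg (n + 1) k R s d)) ∂erlang 0 ∂erlang 0 =
      θ.psicSum (n + 1) k R := by
  have h1 : ∀ s d : ℝ, θ.invArg (n + 1) k R s d = θ.invArg (n + 1) k R 1 1 := by
    intro s d
    simp only [invArg, θ.η_of_perfect h, θ.ζ₁_of_perfect h]
  have h2 := θ.bracket_closedForm hR zero_le_one zero_le_one (hden 1 one_pos)
  rw [θ.η_of_perfect h, θ.ζ₁_of_perfect h] at h2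
  rw [psicSum]
  simp only [h1, h2, integral_const, probReal_univ, one_smul, orderCdf]

end SystemParams

/-! ### The outage probability as a double integral -/

section Outage

variable {Ω : Type*} [MeasurableSpace Ω] {μ : Measure Ω}

lemma map_norm_sq_of_hasLaw {N : ℝ} (hN : 0 ≤ N) {h : Ω → ℂ}
    (hh : HasLaw h (complexGaussian N) μ) :
    μ.map (fun ω => ‖h ω‖ ^ 2) = (erlang 0).map (fun t => N * t) := by
  have hm := hh.aemeasurable
  rw [← map_norm_sq_complexGaussian hN, ← hh.map_eq,
    AEMeasurable.map_map_of_aemeasurable (by fun_prop) hm]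
  rfl

lemma SystemParams.secrecyOutageProb_mean_eq_integral [IsProbabilityMeasure μ] {K n : ℕ} (θ : SystemParams K) (k : Fin K)
    {R : ℝ} (hR : 0 < R) {G : Fin K → Ω → ℝ} {hipu hipe : Ω → ℂ}
    (hipu_law : HasLaw hipu (complexGaussian θ.Nipu) μ)
    (hipe_law : HasLaw hipe (complexGaussian θ.Nipe) μ) (hG : ∀ i, AEMeasurable (G i) μ)
    (hG_nonneg : ∀ i, ∀ᵐ ω ∂μ, 0 ≤ G i ω)
    (hG_law : ∀ i, μ.map (G i) = gainLaw n (θ.Nbr * θ.Nr k))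
    (hG_indep : iIndepFun (Sum.elim G ![fun ω => ‖hipu ω‖ ^ 2, fun ω => ‖hipe ω‖ ^ 2]) μ)
    (hden : ∀ t : ℝ, 0 < t → θ.η (n + 1) k R t * θ.ν k < θ.a k) :
    θ.secrecyOutageProb μ k R (fun ω => orderStat (fun i => G i ω) k)
      (fun _ => ((n + 1 : ℕ) : ℝ) * θ.Nbr * θ.Nre) (fun ω => ‖hipu ω‖ ^ 2)
      (fun ω => ‖hipe ω‖ ^ 2) =
      ∫ s, ∫ d, orderCdf K (k + 1) (bracketInv n (θ.invArg (n + 1) k R s d))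
        ∂erlang 0 ∂erlang 0 := by
  have hNbr := θ.Nbr_pos
  have hNr := θ.Nr_pos k
  have hNre := θ.Nre_pos
  have hNu := θ.Nipu_pos
  have hNe := θ.Nipe_pos
  have hρ := θ.ρ_pos
  have hϖ := θ.ϖ_nonneg
  have hm1 := hipu_law.aemeasurable
  have hm2 := hipe_law.aemeasurable
  set z : ℝ := ((n + 1 : ℕ) : ℝ) * θ.Nbr * θ.Nre with hz
  have hz0 : 0 ≤ z := by positivity
  let T : ℝ × ℝ → ℝ := fun y => θ.sinrTarget k R z y.2 * (θ.ϖ * θ.ρ * y.1 + 1) /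
    (θ.ρ * (θ.a k - θ.sinrTarget k R z y.2 * θ.ν k))
  have hT : Measurable T := by
    simp only [T, SystemParams.sinrTarget, SystemParams.sinrEve]
    fun_prop
  have hY0 := map_norm_sq_of_hasLaw hNu.le hipu_law
  have hY1 := map_norm_sq_of_hasLaw hNe.le hipe_law
  -- Positivity of the denominators is assumed only for t > 0, so the null event of a vanishing
  -- interference gain has to be discarded.
  have hYe : ∀ᵐ ω ∂μ, 0 < ‖hipe ω‖ ^ 2 := by
    refine ae_of_ae_map (p := fun y => 0 < y) (by fun_prop) ?_
    rw [hY1, ae_map_iff (by fun_prop) measurableSet_Ioi]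
    filter_upwards [ae_erlang_pos 0] with t ht
    exact mul_pos hNe ht
  have hevent : {ω | θ.secrecyRate k (orderStat (fun i => G i ω) k) z (‖hipu ω‖ ^ 2)
      (‖hipe ω‖ ^ 2) < R} =ᵐ[μ] {ω | (k : ℕ) + 1 ≤
        (Finset.univ.filter fun i => G i ω < T (‖hipu ω‖ ^ 2, ‖hipe ω‖ ^ 2)).card} := by
    rw [eventuallyEq_set]
    filter_upwards [hYe, ae_all_iff.2 hG_nonneg] with ω hω hGω
    -- The normalised gain |h_ipe|²/N_ipe plays the role of the unit exponential variable t.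
    have hd := hden (‖hipe ω‖ ^ 2 / θ.Nipe) (by positivity)
    rw [← θ.sinrTarget_mean, mul_div_cancel₀ _ hNe.ne'] at hd
    change θ.secrecyRate k _ _ _ _ < R ↔ _
    have ho : 0 ≤ orderStat (fun i => G i ω) k := hGω _
    rw [θ.secrecyRate_lt_iff k hR ho hz0 (by positivity) (by positivity) hd]
    exact orderStat_lt_iff _ k _
  rw [SystemParams.secrecyOutageProb, measureReal_congr hevent]
  have hY : ∀ j, AEMeasurable (![fun ω => ‖hipu ω‖ ^ 2, fun ω => ‖hipe ω‖ ^ 2] j) μ := by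
    intro j
    fin_cases j
    · exact (hm1.norm).pow_const 2
    · exact (hm2.norm).pow_const 2
  refine (measureReal_card_lt_threshold k hG hY hG_law hY0 hY1 hG_indep hT).trans ?_
  refine integral_congr_ae ?_
  filter_upwards [ae_erlang_pos 0] with s hs
  refine integral_congr_ae ?_
  filter_upwards [ae_erlang_pos 0] with d hd
  have hη := θ.η_pos (n + 1) k hR hs.le
  have hds := hden s hs
  have hTval : T (θ.Nipu * d, θ.Nipe * s) = θ.η (n + 1) k R s * (θ.ϖ * θ.ρ * θ.Nipu * d + 1) /
      (θ.ρ * (θ.a k - θ.η (n + 1) k R s * θ.ν k)) := by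
    simp only [T]
    rw [θ.sinrTarget_mean]
    ring
  have hsub : 0 < θ.a k - θ.η (n + 1) k R s * θ.ν k := by linarith
  rw [hTval, measureReal_gainLaw_Iio n (by positivity) (by positivity)]
  congr 2
  rw [SystemParams.invArg, SystemParams.ζ₁]
  field_simp

end Outage

end RISNOMA

end

/-! ### The main theorem -/

theorem theorem1 {Ω : Type*} [MeasurableSpace Ω] (μ : MeasureTheory.Measure Ω)
    [MeasureTheory.IsProbabilityMeasure μ]
    {K P Q : ℕ} (hQ : 0 < Q) (p : Fin P) (θ : RISNOMA.SystemParams K) (k : Fin K)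
    -- target secrecy rate
    (R : ℝ) (hR : 0 < R)
    -- base station to RIS, RIS to the user, RIS to the eavesdropper: independent Rayleigh fading
    (hbr hrk hre : Fin P × Fin Q → Ω → ℂ)
    (hbr_law : ∀ m, ProbabilityTheory.HasLaw (hbr m) (RISNOMA.complexGaussian θ.Nbr) μ)
    (hrk_law : ∀ m, ProbabilityTheory.HasLaw (hrk m) (RISNOMA.complexGaussian (θ.Nr k)) μ)
    (hre_law : ∀ m, ProbabilityTheory.HasLaw (hre m) (RISNOMA.complexGaussian θ.Nre) μ)
    (h_indep : ProbabilityTheory.iIndepFun (Sum.elim hbr (Sum.elim hrk hre)) μ)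
    -- residual interference after imperfect SIC, at the user and at the eavesdropper
    (hipu hipe : Ω → ℂ)
    (hipu_law : ProbabilityTheory.HasLaw hipu (RISNOMA.complexGaussian θ.Nipu) μ)
    (hipe_law : ProbabilityTheory.HasLaw hipe (RISNOMA.complexGaussian θ.Nipe) μ)
    -- the unordered user gains: independent copies of the cascaded gain, whose order statistic of
    -- rank `k + 1` is the gain of the ordered user
    (G : Fin K → Ω → ℝ)
    (hG_law : ∀ i, ProbabilityTheory.IdentDistrib (G i) (RISNOMA.cascadeGain p hbr hrk) μ μ)
    (hG_indep : ProbabilityTheory.iIndepFun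
      (Sum.elim G ![fun ω => ‖hipu ω‖ ^ 2, fun ω => ‖hipe ω‖ ^ 2]) μ)
    -- the denominators of the closed form are positive
    (hden : ∀ t : ℝ, 0 < t → θ.η Q k R t * θ.ν k < θ.a k) :
    -- the mean gain of the eavesdropper
    (MeasureTheory.Integrable (RISNOMA.cascadeGain p hbr hre) μ ∧
      ∫ ω, RISNOMA.cascadeGain p hbr hre ω ∂μ = (Q : ℝ) * θ.Nbr * θ.Nre) ∧
    -- imperfect SIC: the closed form tends to the secrecy outage probability in which the
    -- eavesdropper's gain is replaced by its mean
    Filter.Tendsto (fun SD : ℕ × ℕ => θ.ipsicSum Q k R SD.1 SD.2) Filter.atTop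
      (nhds (θ.secrecyOutageProb μ k R
        (fun ω => RISNOMA.orderStat (fun i => G i ω) k)
        (fun _ => ∫ ω, RISNOMA.cascadeGain p hbr hre ω ∂μ)
        (fun ω => ‖hipu ω‖ ^ 2) (fun ω => ‖hipe ω‖ ^ 2))) ∧
    -- perfect SIC
    (θ.ϖ = 0 →
      θ.secrecyOutageProb μ k R
        (fun ω => RISNOMA.orderStat (fun i => G i ω) k)
        (fun _ => ∫ ω, RISNOMA.cascadeGain p hbr hre ω ∂μ)
        (fun ω => ‖hipu ω‖ ^ 2) (fun ω => ‖hipe ω‖ ^ 2) = θ.psicSum Q k R) := by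
  obtain ⟨n, rfl⟩ : ∃ n, Q = n + 1 := ⟨Q - 1, by omega⟩
  have hind_k : ProbabilityTheory.iIndepFun (Sum.elim hbr hrk) μ := by
    have := h_indep.precomp (g := Sum.map id Sum.inl)
      (Function.Injective.sumMap Function.injective_id Sum.inl_injective)
    convert! this using 1
    funext i
    cases i <;> rfl
  have hind_e : ProbabilityTheory.iIndepFun (Sum.elim hbr hre) μ := by
    have := h_indep.precomp (g := Sum.map id Sum.inr)
      (Function.Injective.sumMap Function.injective_id Sum.inr_injective)
    convert! this using 1
    funext i
    cases i <;> rfl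
  have hlaw_k := RISNOMA.map_cascadeGain p θ.Nbr_pos.le (θ.Nr_pos k).le hbr_law hrk_law hind_k
  have hlaw_e := RISNOMA.map_cascadeGain p θ.Nbr_pos.le θ.Nre_pos.le hbr_law hre_law hind_e
  have hm_e := RISNOMA.aemeasurable_cascadeGain p (fun m => (hbr_law m).aemeasurable)
    (fun m => (hre_law m).aemeasurable)
  have hint : MeasureTheory.Integrable (RISNOMA.cascadeGain p hbr hre) μ := by
    have h := RISNOMA.integrable_id_gainLaw n (θ.Nbr * θ.Nre)
    rw [← hlaw_e, MeasureTheory.integrable_map_measure (by fun_prop) hm_e] at h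
    exact h
  have hmean : ∫ ω, RISNOMA.cascadeGain p hbr hre ω ∂μ = ((n + 1 : ℕ) : ℝ) * θ.Nbr * θ.Nre := by
    have h := RISNOMA.integral_id_gainLaw n (θ.Nbr * θ.Nre)
    rw [← hlaw_e, MeasureTheory.integral_map hm_e (by fun_prop)] at h
    rw [h]
    push_cast
    ring
  -- The gains `G i` are given only in law, so nonnegativity is transferred from the cascaded gain
  -- and holds almost surely.
  have hG_nonneg : ∀ i, ∀ᵐ ω ∂μ, 0 ≤ G i ω := fun i =>
    (hG_law i).symm.ae_snd measurableSet_Ici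
      (MeasureTheory.ae_of_all _ fun ω => sq_nonneg _)
  have hout := θ.secrecyOutageProb_mean_eq_integral k hR hipu_law hipe_law
    (fun i => (hG_law i).aemeasurable_fst) hG_nonneg
    (fun i => (hG_law i).map_eq.trans hlaw_k) hG_indep hden
  refine ⟨⟨hint, hmean⟩, ?_, fun h => ?_⟩
  · rw [hmean, hout]
    exact θ.tendsto_ipsicSum hR hden
  · rw [hmean, hout]
    exact θ.integral_eq_psicSum hR hden h
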